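/- **Success probability of a cellular V2X network.** *Model.* Let $\lambda_R,\mu_v,\lambda_b,P_v,B>0$, $\sigma^2\ge 0$, path-loss exponents $\alpha_v,\alpha_b>1$ and a radius $R\in[0,\infty]$ be given; if $R=\infty$, assume $\alpha_v,\alpha_b>2$. Roads form a Poisson line process in $\mathbb R^2$: the lines $\{(y\cos\theta-t\sin\theta,\;y\sin\theta+t\cos\theta):t\in\mathbb R\}$, where the points $(\theta,y)$ form a Poisson process on $[0,\pi]\times\mathbb R$ of intensity $\lambda_R\,d\theta\,dy$. One further ("typical") road $L_0$ passes through the origin, where the typical receiver is placed. On each road, including $L_0$, the nodes form a Poisson process of intensity $\mu_v$ per unit length. Base stations (BSs) form a Poisson process of intensity $\lambda_b$ in $\mathbb R^2$. The channel gain $h$ of the serving link and the gains $h_x$ of all nodes $x$ are exponential with mean $1$. The roads, the nodes on the different roads, the BSs and all gains are mutually independent. Let $R_v$ and $R_b$ be the distances from the origin to the nearest node and to the nearest BS. The V2V link is selected (mode $v2v$) if $B R_v^{-\alpha_v}\ge R_b^{-\alpha_b}$, and otherwise the V2B link (mode $v2b$). For a mode $M$ let $\alpha=\alpha_M$ be $\alpha_v$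 if $M=v2v$ and $\alpha_b$ if $M=v2b$. For $r>0$ let $I_r$ be the sum of $P_vh_x|x|^{-\alpha}$ over the nodes $x$ of $L_0$ with $|x|>r$, and let $I_v$ be the same sum over the nodes $x$ with $|x|>r$ on all other roads at distance at most $R$ from the origin. The law of the nodes is not conditioned on $r$: interferers at link distance $r$ are modelled as the unconditioned nodes outside the disc of radius $r$. For a threshold $z>0$ put $$P^S_M(z|r)=\Pr\Big[\tfrac{P_v r^{-\alpha}h}{I_v+I_r+\sigma^2}>z\Big],\quad P^A_{v2v}(v2v|r)=\Pr[Br^{-\alpha_v}\ge R_b^{-\alpha_b}],\quad P^A_{v2b}(v2b|r)=\Pr[BR_v^{-\alpha_v}<r^{-\alpha_b}],$$ and let the overall success probability be $P^S_{V2X}(z)=\mathbb E\big[\mathbf 1_{\{v2v\}}P^S_{v2v}(z|R_v)+\mathbf 1_{\{v2b\}}P^S_{v2b}(z|R_b)\big]$, where the indicators refer to the selected mode. *Expressions.* Put $\Lambda(\rho)=2\pi\lambda_R\int_0^{\rho}\big(1-e^{-2\mu_v\sqrt{\rho^2-y^2}}\big)dy+2\mu_v\rho$. For $M$, $z$, $r$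 put $\alpha=\alpha_M$, $s=\frac{z}{P_vr^{-\alpha}}$, and $$\mathcal L_{out}(s;y)=\exp\Big(-2\mu_v\int_0^\infty\Big[1-\tfrac1{1+sP_v(y^2+t^2)^{-\alpha/2}}\Big]dt\Big),$$ $$\mathcal L_{in}(s|r;y)=\exp\Big(-2\mu_v\int_{\sqrt{r^2-y^2}}^\infty\Big[1-\tfrac1{1+sP_v(y^2+t^2)^{-\alpha/2}}\Big]dt\Big),$$ $$\mathcal L_{I_v}(s|r)=\exp\Big(-2\pi\lambda_R\int_{0<y\le r,\;y\le R}\big(1-\mathcal L_{in}(s|r;y)\big)dy\Big)\exp\Big(-2\pi\lambda_R\int_{y>r,\;y\le R}\big(1-\mathcal L_{out}(s;y)\big)dy\Big),$$ $$\mathcal L_{I_r}(s|r)=\exp\Big(-\tfrac{2rz\mu_v}{\alpha-1}\,{}_2F_1\big(1,\tfrac{\alpha-1}{\alpha};2-\tfrac1\alpha;-z\big)\Big),$$ where ${}_2F_1$ is the Gauss hypergeometric function (analytically continued along the negative axis). *Claim.* (a) $R_v$ and $R_b$ have on $(0,\infty)$ the densities $$f_{R_v}(r)=\Big(4\pi\lambda_R\mu_v\int_0^r\tfrac{r\,e^{-2\mu_v\sqrt{r^2-y^2}}}{\sqrt{r^2-y^2}}dy+2\mu_v\Big)e^{-\Lambda(r)},\qquad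 f_{R_b}(r)=2\pi\lambda_b r\,e^{-\pi\lambda_br^2}.$$ (b) For all $r>0$ and both modes $M$, $$P^S_M(z|r)=\exp\Big(-\tfrac{z\sigma^2}{P_vr^{-\alpha}}\Big)\mathcal L_{I_v}(s|r)\,\mathcal L_{I_r}(s|r).$$ (c) For all $r>0$, $$P^A_{v2v}(v2v|r)=\exp\Big(-\pi\lambda_b\big(r^{\alpha_v/\alpha_b}/B^{1/\alpha_b}\big)^2\Big),\qquad P^A_{v2b}(v2b|r)=\exp\big(-\Lambda(B^{1/\alpha_v}r^{\alpha_b/\alpha_v})\big).$$ (d) With the expressions of (a)–(c) inserted, both integrands below are integrable and $$P^S_{V2X}(z)=\int_0^\infty P^S_{v2v}(z|r)\,P^A_{v2v}(v2v|r)\,f_{R_v}(r)\,dr+\int_0^\infty P^S_{v2b}(z|r)\,P^A_{v2b}(v2b|r)\,f_{R_b}(r)\,dr.$$ -/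

import Mathlib

open MeasureTheory ProbabilityTheory Set
open scoped ENNReal NNReal

noncomputable section

namespace V2X

/-! ### Poisson point processes -/

/-- The number of points of the random sequence `X` that lie in the set `A`. -/
def pointCount {Ω E : Type*} (X : ℕ → Ω → E) (A : Set E) (ω : Ω) : ℝ≥0∞ :=
  ∑' n, A.indicator (fun _ => (1 : ℝ≥0∞)) (X n ω)

/-- The random points `X 0, X 1, …` form a Poisson point process with intensity measure `Λ`
(of infinite total mass, so that there are infinitely many points): the number of points in a
measurable set of finite intensity is Poisson distributed with the intensity as its mean, and the
numbers of points in pairwise disjoint measurable sets are independent. -/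
structure IsPoissonProcess {Ω E : Type*} [MeasurableSpace Ω] [MeasurableSpace E]
    (X : ℕ → Ω → E) (Λ : Measure E) (P : Measure Ω) : Prop where
  measurable : ∀ n, Measurable (X n)
  count_law : ∀ A : Set E, MeasurableSet A → Λ A ≠ ∞ →
    HasLaw (pointCount X A)
      ((poissonMeasure (Λ A).toNNReal).map (fun k : ℕ => (k : ℝ≥0∞))) P
  count_indep : ∀ (m : ℕ) (A : Fin m → Set E), (∀ i, MeasurableSet (A i)) →
    Pairwise (fun i j => Disjoint (A i) (A j)) →
    iIndepFun (fun i => pointCount X (A i)) P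

/-! ### Parameters of the network -/

/-- The two transmission modes: vehicle to vehicle, and vehicle to base station. -/
inductive Mode
  | v2v
  | v2b

/-- The parameters of the network. -/
structure Params where
  /-- intensity of the roads -/
  lamR : ℝ
  /-- intensity of the nodes on each road -/
  muv : ℝ
  /-- intensity of the base stations -/
  lamb : ℝ
  /-- transmit power of the vehicles -/
  Pv : ℝ
  /-- association bias -/
  B : ℝ
  /-- thermal noise power -/
  noise : ℝ
  /-- path-loss exponent of the V2V links -/
  alphav : ℝ
  /-- path-loss exponent of the V2B links -/
  alphab : ℝ
  /-- radius of the disc around the origin whose roads carry interferers (possibly infinite) -/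
  R : ℝ≥0∞
  /-- direction of the normal of the typical road through the origin -/
  theta0 : ℝ
  lamR_pos : 0 < lamR
  muv_pos : 0 < muv
  lamb_pos : 0 < lamb
  Pv_pos : 0 < Pv
  B_pos : 0 < B
  noise_nonneg : 0 ≤ noise
  one_lt_alphav : 1 < alphav
  one_lt_alphab : 1 < alphab
  /-- With roads in the whole plane, the interference is finite only for exponents above `2`. -/
  two_lt_of_R_eq_top : R = ∞ → 2 < alphav ∧ 2 < alphab

/-- The path-loss exponent of a mode. -/
def Params.alpha (p : Params) : Mode → ℝ
  | .v2v => p.alphav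
  | .v2b => p.alphab

/-- The point with signed coordinate `t` (measured from the foot of the perpendicular from the
origin) on the line with normal direction `θ` and signed distance `y` from the origin. -/
def roadPoint (L : ℝ × ℝ) (t : ℝ) : EuclideanSpace ℝ (Fin 2) :=
  !₂[L.2 * Real.cos L.1 - t * Real.sin L.1, L.2 * Real.sin L.1 + t * Real.cos L.1]

/-! ### The stochastic model -/

/-- Labels of the independent sources of randomness. Roads are labelled by `Option ℕ`: `none` is
the typical road through the origin and `some i` is the `i`-th road of the line process. -/
inductive Source
  | roads
  | nodes (k : Option ℕ)
  | stations
  | gain (k : Option ℕ) (j : ℕ)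
  | linkGain

/-- The network seen from a typical receiver at the origin. -/
structure Network (p : Params) {Ω : Type*} [MeasurableSpace Ω] (P : Measure Ω) where
  /-- the coordinates `(θ, y)` of the roads in the representation space `[0, π] × ℝ` -/
  road : ℕ → Ω → ℝ × ℝ
  /-- the coordinates of the nodes along each road -/
  node : Option ℕ → ℕ → Ω → ℝ
  /-- the positions of the base stations -/
  station : ℕ → Ω → EuclideanSpace ℝ (Fin 2)
  /-- the channel gain between the origin and each node -/
  gain : Option ℕ → ℕ → Ω → ℝ
  /-- the channel gain of the serving link -/
  linkGain : Ω → ℝ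
  road_poisson : IsPoissonProcess road
    (ENNReal.ofReal p.lamR • (volume.restrict (Icc (0 : ℝ) Real.pi)).prod (volume : Measure ℝ)) P
  node_poisson : ∀ k, IsPoissonProcess (node k) (ENNReal.ofReal p.muv • (volume : Measure ℝ)) P
  station_poisson : IsPoissonProcess station
    (ENNReal.ofReal p.lamb • (volume : Measure (EuclideanSpace ℝ (Fin 2)))) P
  gain_measurable : ∀ k j, Measurable (gain k j)
  gain_law : ∀ k j, HasLaw (gain k j) (expMeasure 1) P
  linkGain_measurable : Measurable linkGain
  linkGain_law : HasLaw linkGain (expMeasure 1) P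
  /-- the roads, the nodes on the different roads, the base stations and all the channel gains are
  mutually independent -/
  indep : iIndep (fun s : Source => match s with
    | .roads => MeasurableSpace.comap (fun ω n => road n ω) inferInstance
    | .nodes k => MeasurableSpace.comap (fun ω j => node k j ω) inferInstance
    | .stations => MeasurableSpace.comap (fun ω n => station n ω) inferInstance
    | .gain k j => MeasurableSpace.comap (gain k j) inferInstance
    | .linkGain => MeasurableSpace.comap linkGain inferInstance) P

namespace Network

variable {p : Params} {Ω : Type*} [MeasurableSpace Ω] {P : Measure Ω} (N : Network p P)

/-- The line that carries the road with label `k`. -/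
def line : Option ℕ → Ω → ℝ × ℝ
  | none, _ => (p.theta0, 0)
  | some i, ω => N.road i ω

/-- The position in the plane of the `j`-th node on the road `k`. -/
def position (k : Option ℕ) (j : ℕ) (ω : Ω) : EuclideanSpace ℝ (Fin 2) :=
  roadPoint (N.line k ω) (N.node k j ω)

/-- The shortest V2V distance: the distance from the origin to the nearest node. -/
def Rv (ω : Ω) : ℝ := ⨅ q : Option ℕ × ℕ, ‖N.position q.1 q.2 ω‖

/-- The V2B distance: the distance from the origin to the nearest base station. -/
def Rb (ω : Ω) : ℝ := ⨅ n : ℕ, ‖N.station n ω‖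

/-- The power received at the origin from the nodes on the road `k` outside the closed disc of
radius `r`, with path-loss exponent `α`. -/
def roadPower (α r : ℝ) (k : Option ℕ) (ω : Ω) : ℝ≥0∞ :=
  ∑' j : ℕ, if r < ‖N.position k j ω‖ then
    ENNReal.ofReal (p.Pv * N.gain k j ω * ‖N.position k j ω‖ ^ (-α)) else 0

/-- The interference from the road through the origin. -/
def Ir (α r : ℝ) (ω : Ω) : ℝ≥0∞ := N.roadPower α r none ω

/-- The interference from all other roads that meet the disc of radius `R`. -/
def Iv (α r : ℝ) (ω : Ω) : ℝ≥0∞ :=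
  ∑' i : ℕ, if ENNReal.ofReal |(N.road i ω).2| ≤ p.R then N.roadPower α r (some i) ω else 0

/-- The SINR of the typical receiver in mode `M` over a link of length `r`. -/
def sinr (M : Mode) (r : ℝ) (ω : Ω) : ℝ≥0∞ :=
  ENNReal.ofReal (p.Pv * r ^ (-(p.alpha M)) * N.linkGain ω) /
    (N.Iv (p.alpha M) r ω + N.Ir (p.alpha M) r ω + ENNReal.ofReal p.noise)

/-- The conditional success probability `P_M^S(z | r)`. -/
def condSuccess (M : Mode) (z r : ℝ) : ℝ≥0∞ := P {ω | ENNReal.ofReal z < N.sinr M r ω}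

/-- The conditional probability `P_{v2v}^A(v2v | r)` that the V2V link is selected when the V2V
distance is `r`. -/
def condAssocV2V (r : ℝ) : ℝ≥0∞ := P {ω | N.Rb ω ^ (-p.alphab) ≤ p.B * r ^ (-p.alphav)}

/-- The conditional probability `P_{v2b}^A(v2b | r)` that the V2B link is selected when the V2B
distance is `r`. -/
def condAssocV2B (r : ℝ) : ℝ≥0∞ := P {ω | p.B * N.Rv ω ^ (-p.alphav) < r ^ (-p.alphab)}

/-- The mode that the link selection rule picks. -/
def mode (ω : Ω) : Mode :=
  if N.Rb ω ^ (-p.alphab) ≤ p.B * N.Rv ω ^ (-p.alphav) then .v2v else .v2b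

/-- The shortest distance in a given mode. -/
def dist : Mode → Ω → ℝ
  | .v2v => N.Rv
  | .v2b => N.Rb

/-- The overall success probability `P_{V2X}^S(z)`: the conditional success probability in the
selected mode at the distance of the selected link, averaged over both. -/
def success (z : ℝ) : ℝ≥0∞ :=
  ∫⁻ ω, N.condSuccess (N.mode ω) z (N.dist (N.mode ω) ω) ∂P

end Network

/-! ### The closed-form expressions -/

/-- The Gauss hypergeometric function `₂F₁(a, b; c; x)` for `0 < b < c` and real `x < 1`, by
Euler's integral. (Mathlib's `ordinaryHypergeometric` is the power series, which does not
represent the function for `x < -1`.) -/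
def hyp2F1 (a b c x : ℝ) : ℝ :=
  Real.Gamma c / (Real.Gamma b * Real.Gamma (c - b)) *
    ∫ t in (0 : ℝ)..1, t ^ (b - 1) * (1 - t) ^ (c - b - 1) * (1 - x * t) ^ (-a)

namespace Params

variable (p : Params)

/-- The exponent `2 π λ_R ∫₀^r (1 - exp (-2 μ_v √(r² - y²))) dy + 2 μ_v r`, without sign. -/
def voidExponent (r : ℝ) : ℝ :=
  2 * Real.pi * p.lamR *
      (∫ y in (0 : ℝ)..r, (1 - Real.exp (-2 * p.muv * Real.sqrt (r ^ 2 - y ^ 2)))) +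
    2 * p.muv * r

/-- The density of the V2V distance. -/
def pdfRv (r : ℝ) : ℝ :=
  (4 * Real.pi * p.lamR * p.muv *
      (∫ y in (0 : ℝ)..r, r * Real.exp (-2 * p.muv * Real.sqrt (r ^ 2 - y ^ 2)) /
        Real.sqrt (r ^ 2 - y ^ 2)) + 2 * p.muv) *
    Real.exp (-p.voidExponent r)

/-- The density of the V2B distance. -/
def pdfRb (r : ℝ) : ℝ :=
  2 * Real.pi * p.lamb * r * Real.exp (-Real.pi * p.lamb * r ^ 2)

/-- The expression for `P_{v2v}^A(v2v | r)`. -/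
def assocV2V (r : ℝ) : ℝ :=
  Real.exp (-Real.pi * p.lamb * (r ^ (p.alphav / p.alphab) / p.B ^ (1 / p.alphab)) ^ 2)

/-- The expression for `P_{v2b}^A(v2b | r)`. -/
def assocV2B (r : ℝ) : ℝ :=
  Real.exp (-p.voidExponent (p.B ^ (1 / p.alphav) * r ^ (p.alphab / p.alphav)))

/-- Laplace transform of the interference from a road at distance `y > r`. -/
def lapOut (α s y : ℝ) : ℝ :=
  Real.exp (-2 * p.muv *
    ∫ t in Ioi (0 : ℝ), (1 - 1 / (1 + s * p.Pv * (y ^ 2 + t ^ 2) ^ (-α / 2))))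

/-- Laplace transform of the interference from a road at distance `y ≤ r`. -/
def lapIn (α s r y : ℝ) : ℝ :=
  Real.exp (-2 * p.muv *
    ∫ t in Ioi (Real.sqrt (r ^ 2 - y ^ 2)),
      (1 - 1 / (1 + s * p.Pv * (y ^ 2 + t ^ 2) ^ (-α / 2))))

/-- Laplace transform of the interference from all roads, except the typical one, that meet the
disc of radius `R`. -/
def lapIv (α s r : ℝ) : ℝ :=
  Real.exp (-2 * Real.pi * p.lamR *
      ∫ y in Ioc 0 r ∩ {y | ENNReal.ofReal y ≤ p.R}, (1 - p.lapIn α s r y)) *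
    Real.exp (-2 * Real.pi * p.lamR *
      ∫ y in Ioi r ∩ {y | ENNReal.ofReal y ≤ p.R}, (1 - p.lapOut α s y))

/-- Laplace transform of the interference from the typical road, at `s = z r ^ α / P_v`. -/
def lapIr (α z r : ℝ) : ℝ :=
  Real.exp (-(2 * r * z * p.muv * hyp2F1 1 ((α - 1) / α) (2 - 1 / α) (-z) / (α - 1)))

/-- The expression for the conditional success probability `P_M^S(z | r)`. -/
def succ (M : Mode) (z r : ℝ) : ℝ :=
  Real.exp (-(z * p.noise / (p.Pv * r ^ (-(p.alpha M))))) *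
    p.lapIv (p.alpha M) (z / (p.Pv * r ^ (-(p.alpha M)))) r *
    p.lapIr (p.alpha M) z r

end Params

end V2X

end

/-!
Every quantity of the network is obtained from a single Laplace functional. Write `expNeg x` for
`exp (-x)` on `[0, ∞]`.

For a Poisson process `X` with intensity `Λ`, `E expNeg (∑ g (X n)) = expNeg (∫ (1 - expNeg g) dΛ)`
(`IsPoissonProcess.lintegral_expNeg_tsum`). For a step function `g` this is the product of the
Laplace transforms of independent Poisson counts, and the general case follows by monotone
approximation. Independent marks are averaged out first, given the points, so that `expNeg g`
may be replaced by an expectation over a mark (`IsPoissonProcess.lintegral_expNeg_marked`).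

The nodes form a Cox process. The nodes of a road together with their gains are a mark of that
road, and their own Laplace functional is again that of a marked Poisson process. Applying the
marked formula along each road and then over the roads gives the Laplace functional of the whole
network (`Network.lintegral_expNeg_totalSum`), which is used for two functions of a node.

* For the function that is `∞` in the disc of radius `r` and `0` outside, it is the probability that
  the disc is empty, that is, the tail of `R_v`. The tail of `R_b` comes from the Poisson process of
  stations in the same way. Differentiating the void exponent, after the substitution `y = r sin φ`
  that removes the singularity of the integrand, gives the density of `R_v`, and the association
  probabilities are values of the two tails.
* For the interference of the nodes outside the disc of radius `r`, weighted by `s`, it is the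
  Laplace transform of the interference. An exponential link gain exceeds an independent threshold
  `T` with probability `E expNeg T`, so this is, up to the factor of the noise, the conditional
  success probability. The average over a gain gives the factors `1 / (1 + s P_v |x| ^ (-α))`, and
  on the road through the origin the substitution `t = r u ^ (-1 / α)` produces Euler's integral for
  `₂F₁`. When roads of the whole plane interfere, the exponent of a road at distance `y` is of order
  `y ^ (1 - α)`, which is integrable at infinity because `α > 2`.

Finally `R_v` and `R_b` depend on disjoint sets of independent sources, so the overall success
probability is a double integral against the product of their laws, and integrating out the
distance of the link that is not selected leaves the association probabilities
(`Network.success_eq_lintegral`).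
-/

noncomputable section

open Filter Topology

namespace V2X

/-! ### The function `x ↦ exp (-x)` on `[0, ∞]` -/

/-- The function `x ↦ exp (-x)` from `[0, ∞]` to `[0, 1]`, with the value `0` at `∞`. -/
def expNeg (x : ℝ≥0∞) : ℝ≥0∞ := EReal.exp (-(x : EReal))

@[simp] lemma expNeg_zero : expNeg 0 = 1 := by simp [expNeg]

@[simp] lemma expNeg_top : expNeg ∞ = 0 := by simp [expNeg]

lemma expNeg_ofReal {a : ℝ} (ha : 0 ≤ a) :
    expNeg (ENNReal.ofReal a) = ENNReal.ofReal (Real.exp (-a)) := by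
  rw [expNeg, EReal.coe_ennreal_ofReal, max_eq_left ha, ← EReal.coe_neg, EReal.exp_coe]

lemma expNeg_coe (a : ℝ≥0) : expNeg a = ENNReal.ofReal (Real.exp (-a)) := by
  rw [← expNeg_ofReal a.coe_nonneg, ENNReal.ofReal_coe_nnreal]

lemma expNeg_add (x y : ℝ≥0∞) : expNeg (x + y) = expNeg x * expNeg y := by
  rw [expNeg, EReal.coe_ennreal_add, EReal.neg_add (by simp) (by simp), sub_eq_add_neg,
    EReal.exp_add, expNeg, expNeg]

lemma expNeg_sum {ι : Type*} (s : Finset ι) (f : ι → ℝ≥0∞) :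
    expNeg (∑ i ∈ s, f i) = ∏ i ∈ s, expNeg (f i) := by
  classical
  induction s using Finset.induction_on with
  | empty => simp
  | insert a s ha ih => rw [Finset.sum_insert ha, Finset.prod_insert ha, expNeg_add, ih]

lemma antitone_expNeg : Antitone expNeg := fun x y h => by
  rw [expNeg, expNeg, EReal.exp_le_exp_iff, EReal.neg_le_neg_iff]
  exact_mod_cast h

lemma expNeg_le_one (x : ℝ≥0∞) : expNeg x ≤ 1 := by
  simpa using antitone_expNeg (zero_le (a := x))

lemma continuous_expNeg : Continuous expNeg :=
  ENNReal.continuous_exp.comp (continuous_neg.comp continuous_coe_ennreal_ereal)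

@[fun_prop]
lemma measurable_expNeg : Measurable expNeg := continuous_expNeg.measurable

/-- Every number in `[0, 1]` is a value of `expNeg`, with a preimage that depends measurably on
it. -/
lemma exists_measurable_expNeg_eq :
    ∃ l : ℝ≥0∞ → ℝ≥0∞, Measurable l ∧ ∀ v, v ≤ 1 → expNeg (l v) = v := by
  refine ⟨fun v => (-(ENNReal.log v)).toENNReal, by fun_prop, fun v hv => ?_⟩
  have : 0 ≤ -(ENNReal.log v) := by
    rw [EReal.neg_nonneg]
    simpa using ENNReal.log_monotone hv
  rw [expNeg, EReal.coe_toENNReal this, neg_neg, ENNReal.exp_log]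

lemma tendsto_prod_expNeg (f : ℕ → ℝ≥0∞) :
    Tendsto (fun N => ∏ n ∈ Finset.range N, expNeg (f n)) atTop (𝓝 (expNeg (∑' n, f n))) := by
  simp_rw [← expNeg_sum]
  exact (continuous_expNeg.tendsto _).comp ENNReal.summable.hasSum.tendsto_sum_nat

/-! ### The Laplace functional of a Poisson process -/

section Laplace

variable {Ω E : Type*} [MeasurableSpace Ω] [MeasurableSpace E]

/-- The Laplace transform of the Poisson distribution. -/
lemma lintegral_expNeg_mul_poissonMeasure (c l : ℝ≥0) :
    ∫⁻ k : ℕ, expNeg (c * k) ∂(poissonMeasure l) = expNeg ((1 - expNeg c) * l) := by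
  have hs := (NormedSpace.expSeries_div_hasSum_exp ((l : ℝ) * Real.exp (-c))).mul_left
    (Real.exp (-l))
  rw [← Real.exp_eq_exp_ℝ] at hs
  have h1 : Real.exp (-(c : ℝ)) ≤ 1 := by simp
  have h2 : ∀ k : ℕ, expNeg (c * k) * poissonMeasure l {k} =
      ENNReal.ofReal (Real.exp (-l) * (((l : ℝ) * Real.exp (-c)) ^ k / k.factorial)) := by
    intro k
    have : (c : ℝ≥0∞) * k = ((c * k : ℝ≥0) : ℝ≥0∞) := by push_cast; rfl
    rw [poissonMeasure_singleton, this, expNeg_coe, ← ENNReal.ofReal_mul (by positivity)]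
    congr 1
    rw [mul_pow, ← Real.exp_nat_mul]
    push_cast
    ring_nf
  rw [lintegral_countable']
  simp_rw [h2]
  rw [← ENNReal.ofReal_tsum_of_nonneg (fun k => by positivity) hs.summable, hs.tsum_eq,
    ← Real.exp_add, expNeg_coe, ← ENNReal.ofReal_one, ← ENNReal.ofReal_sub _ (Real.exp_nonneg _),
    ← ENNReal.ofReal_coe_nnreal, ← ENNReal.ofReal_mul (by linarith), expNeg_ofReal
      (mul_nonneg (by linarith) l.coe_nonneg)]
  ring_nf

variable {X : ℕ → Ω → E} {Λ : Measure E} {P : Measure Ω}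

lemma measurable_pointCount (hX : ∀ n, Measurable (X n)) {A : Set E} (hA : MeasurableSet A) :
    Measurable (pointCount X A) :=
  Measurable.tsum fun n => (measurable_const.indicator hA).comp (hX n)

lemma IsPoissonProcess.lintegral_expNeg_pointCount (hX : IsPoissonProcess X Λ P) {A : Set E}
    (hA : MeasurableSet A) (hΛ : Λ A ≠ ∞) (c : ℝ≥0) :
    ∫⁻ ω, expNeg (c * pointCount X A ω) ∂P = expNeg ((1 - expNeg c) * Λ A) := by
  rw [(hX.count_law A hA hΛ).lintegral_comp (f := fun x => expNeg (c * x)) (by fun_prop),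
    lintegral_map (by fun_prop) (by fun_prop), lintegral_expNeg_mul_poissonMeasure,
    ENNReal.coe_toNNReal hΛ]

/-- The Laplace functional at a step function with finitely many steps of finite intensity: by the
independence of the counts it is a product of Laplace transforms of Poisson variables. -/
lemma IsPoissonProcess.lintegral_expNeg_sum (hX : IsPoissonProcess X Λ P) {m : ℕ}
    {A : Fin m → Set E} (hA : ∀ i, MeasurableSet (A i))
    (hd : Pairwise fun i j => Disjoint (A i) (A j)) (hΛ : ∀ i, Λ (A i) ≠ ∞) (c : Fin m → ℝ≥0) :
    ∫⁻ ω, expNeg (∑ i, c i * pointCount X (A i) ω) ∂P =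
      expNeg (∑ i, (1 - expNeg (c i)) * Λ (A i)) := by
  simp_rw [expNeg_sum]
  rw [lintegral_prod_eq_prod_lintegral_of_indepFun Finset.univ
    (fun i ω => expNeg (c i * pointCount X (A i) ω))]
  · exact Finset.prod_congr rfl fun i _ => hX.lintegral_expNeg_pointCount (hA i) (hΛ i) (c i)
  · exact (hX.count_indep m A hA hd).comp (fun i x => expNeg (c i * x)) (fun i => by fun_prop)
  · intro i
    have := measurable_pointCount hX.measurable (hA i)
    fun_prop

/-- The Laplace functional at a simple function whose support has finite intensity: its level sets
at nonzero values are disjoint sets of finite intensity. -/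
lemma IsPoissonProcess.lintegral_expNeg_simpleFunc (hX : IsPoissonProcess X Λ P)
    (f : SimpleFunc E ℝ≥0∞) (hf : ∀ x, f x ≠ ∞) (hΛ : Λ (Function.support f) ≠ ∞) :
    ∫⁻ ω, expNeg (∑' n, f (X n ω)) ∂P = expNeg (∫⁻ x, (1 - expNeg (f x)) ∂Λ) := by
  classical
  set s := f.range.filter (· ≠ 0)
  let e := s.equivFin.symm
  let A : Fin s.card → Set E := fun i => f ⁻¹' {(e i : ℝ≥0∞)}
  have hmem : ∀ i, (e i : ℝ≥0∞) ∈ f.range ∧ (e i : ℝ≥0∞) ≠ 0 := fun i => by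
    exact Finset.mem_filter.1 (e i).2
  have htop : ∀ i, (e i : ℝ≥0∞) ≠ ∞ := fun i => by
    obtain ⟨x, hx⟩ := SimpleFunc.mem_range.1 (hmem i).1
    exact hx ▸ hf x
  have hA : ∀ i, MeasurableSet (A i) := fun i => f.measurableSet_preimage _
  have hd : Pairwise fun i j => Disjoint (A i) (A j) := fun i j hij => by
    refine Set.disjoint_left.2 fun x hx hx' => hij (e.injective (Subtype.ext ?_))
    exact (mem_singleton_iff.1 hx).symm.trans (mem_singleton_iff.1 hx')
  have hΛA : ∀ i, Λ (A i) ≠ ∞ := fun i => by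
    refine ne_top_of_le_ne_top hΛ (measure_mono fun x hx => ?_)
    rw [Function.mem_support, mem_singleton_iff.1 hx]
    exact (hmem i).2
  -- used for `φ = id` and for `φ = 1 - expNeg`, which both vanish at `0`
  have key : ∀ (φ : ℝ≥0∞ → ℝ≥0∞), φ 0 = 0 → ∀ x,
      φ (f x) = ∑ i, φ (e i) * (A i).indicator (fun _ => (1 : ℝ≥0∞)) x := by
    intro φ hφ x
    by_cases hx : f x = 0
    · rw [hx, hφ, Finset.sum_eq_zero]
      intro i _
      rw [indicator_of_notMem, mul_zero]
      intro h
      exact (hmem i).2 ((mem_singleton_iff.1 h).symm.trans hx)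
    · have hxs : f x ∈ s := by simp [s, hx]
      rw [Finset.sum_eq_single (e.symm ⟨f x, hxs⟩)]
      · rw [indicator_of_mem (by simp [A]), mul_one, Equiv.apply_symm_apply]
      · intro j _ hj
        rw [indicator_of_notMem, mul_zero]
        intro h
        apply hj
        rw [Equiv.eq_symm_apply]
        exact Subtype.ext (mem_singleton_iff.1 h).symm
      · simp
  have h1 : ∀ ω, ∑' n, f (X n ω) = ∑ i, ((e i : ℝ≥0∞).toNNReal : ℝ≥0∞) * pointCount X (A i) ω := by
    intro ω
    have hk := key id rfl
    simp only [id] at hk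
    simp_rw [hk]
    rw [Summable.tsum_finsetSum fun _ _ => ENNReal.summable]
    refine Finset.sum_congr rfl fun i _ => ?_
    rw [ENNReal.tsum_mul_left, ENNReal.coe_toNNReal (htop i), pointCount]
  simp_rw [h1]
  rw [hX.lintegral_expNeg_sum hA hd hΛA]
  congr 1
  simp_rw [key (fun y => 1 - expNeg y) (by simp)]
  rw [lintegral_finsetSum _ fun i _ => (measurable_const.indicator (hA i)).const_mul _]
  refine Finset.sum_congr rfl fun i _ => ?_
  rw [lintegral_const_mul _ (measurable_const.indicator (hA i)), lintegral_indicator_const (hA i),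
    one_mul, ENNReal.coe_toNNReal (htop i)]

/-- The Laplace functional of a Poisson process. -/
theorem IsPoissonProcess.lintegral_expNeg_tsum [IsProbabilityMeasure P] [SigmaFinite Λ]
    (hX : IsPoissonProcess X Λ P) {g : E → ℝ≥0∞} (hg : Measurable g) :
    ∫⁻ ω, expNeg (∑' n, g (X n ω)) ∂P = expNeg (∫⁻ x, (1 - expNeg (g x)) ∂Λ) := by
  -- the restriction to spanning sets makes the intensity of the supports finite
  let f : ℕ → SimpleFunc E ℝ≥0∞ := fun k => (SimpleFunc.eapprox g k).restrict (spanningSets Λ k)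
  have hfe : ∀ k, (f k : E → ℝ≥0∞) = (spanningSets Λ k).indicator (SimpleFunc.eapprox g k) :=
    fun k => SimpleFunc.coe_restrict _ (measurableSet_spanningSets Λ k)
  have hmono : ∀ x, Monotone fun k => f k x := fun x k l hkl => by
    simp only [hfe]
    exact (indicator_le_indicator_of_subset (monotone_spanningSets Λ hkl)
      (fun _ => zero_le) x).trans (indicator_le_indicator (SimpleFunc.monotone_eapprox g hkl x))
  have hlim : ∀ x, Tendsto (fun k => f k x) atTop (𝓝 (g x)) := fun x => by
    have h1 : Tendsto (fun k => SimpleFunc.eapprox g k x) atTop (𝓝 (g x)) := by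
      rw [← SimpleFunc.iSup_eapprox_apply hg x]
      exact tendsto_atTop_iSup fun k l hkl => SimpleFunc.monotone_eapprox g hkl x
    refine h1.congr' ?_
    filter_upwards [eventually_ge_atTop (spanningSetsIndex Λ x)] with k hk
    rw [hfe, indicator_of_mem]
    exact monotone_spanningSets Λ hk (mem_spanningSetsIndex Λ x)
  have hstep : ∀ k, ∫⁻ ω, expNeg (∑' n, f k (X n ω)) ∂P =
      expNeg (∫⁻ x, (1 - expNeg (f k x)) ∂Λ) := fun k => by
    refine hX.lintegral_expNeg_simpleFunc (f k) (fun x => ?_) ?_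
    · refine ne_top_of_le_ne_top (SimpleFunc.eapprox_lt_top g k x).ne ?_
      rw [hfe]
      exact indicator_le_self' (fun _ _ => zero_le) x
    · refine ne_top_of_le_ne_top (measure_spanningSets_lt_top Λ k).ne (measure_mono ?_)
      rw [hfe]
      exact support_indicator_subset
  have hleft : Tendsto (fun k => ∫⁻ ω, expNeg (∑' n, f k (X n ω)) ∂P) atTop
      (𝓝 (∫⁻ ω, expNeg (∑' n, g (X n ω)) ∂P)) := by
    refine tendsto_lintegral_of_dominated_convergence (fun _ => 1) (fun k => ?_)
      (fun k => ae_of_all _ fun ω => expNeg_le_one _) (by simp) (ae_of_all _ fun ω => ?_)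
    · exact measurable_expNeg.comp
        (Measurable.tsum fun n => (f k).measurable.comp (hX.measurable n))
    · refine (continuous_expNeg.tendsto _).comp ?_
      simp_rw [← lintegral_count]
      exact lintegral_tendsto_of_tendsto_of_monotone (fun k => measurable_from_top.aemeasurable)
        (ae_of_all _ fun n => hmono _) (ae_of_all _ fun n => hlim _)
  have hright : Tendsto (fun k => expNeg (∫⁻ x, (1 - expNeg (f k x)) ∂Λ)) atTop
      (𝓝 (expNeg (∫⁻ x, (1 - expNeg (g x)) ∂Λ))) := by
    refine (continuous_expNeg.tendsto _).comp (lintegral_tendsto_of_tendsto_of_monotone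
      (fun k => ?_) (ae_of_all _ fun x => ?_) (ae_of_all _ fun x => ?_))
    · have := (f k).measurable
      fun_prop
    · exact fun k l hkl => tsub_le_tsub_left (antitone_expNeg (hmono x hkl)) 1
    · exact ENNReal.Tendsto.sub tendsto_const_nhds ((continuous_expNeg.tendsto _).comp (hlim x))
        (Or.inl ENNReal.one_ne_top)
  exact tendsto_nhds_unique (hleft.congr hstep) hright

end Laplace

/-! ### Independent marks -/

section Marks

variable {Ω E F : Type*} [mΩ : MeasurableSpace Ω] [MeasurableSpace E] [MeasurableSpace F]
  {P : Measure Ω} {X : ℕ → Ω → E} {Y : ℕ → Ω → F}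

lemma measurable_lintegral_expNeg_mark [SFinite P] {Z : Ω → F} (hZ : Measurable Z)
    {H : E → F → ℝ≥0∞} (hH : Measurable (Function.uncurry H)) :
    Measurable fun x => ∫⁻ ω, expNeg (H x (Z ω)) ∂P := by
  refine Measurable.lintegral_prod_right' (f := fun q : E × Ω => expNeg (H q.1 (Z q.2))) ?_
  exact measurable_expNeg.comp (hH.comp (measurable_fst.prodMk (hZ.comp measurable_snd)))

/-- Averaging over independent marks `Y n` that are also independent of the points `X n`: given
the points, the expectation of the product is the product of the expectations. -/
lemma lintegral_prod_expNeg_marked [IsProbabilityMeasure P] (hX : ∀ n, Measurable (X n))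
    (hY : ∀ n, Measurable (Y n)) (hXY : IndepFun (fun ω n => X n ω) (fun ω n => Y n ω) P)
    (hYi : iIndepFun Y P) {H : E → F → ℝ≥0∞} (hH : Measurable (Function.uncurry H))
    {v : E → ℝ≥0∞} (hv : ∀ n x, ∫⁻ ω, expNeg (H x (Y n ω)) ∂P = v x) (N : ℕ) :
    ∫⁻ ω, ∏ n ∈ Finset.range N, expNeg (H (X n ω) (Y n ω)) ∂P =
      ∫⁻ ω, ∏ n ∈ Finset.range N, v (X n ω) ∂P := by
  have hX' : Measurable fun ω n => X n ω := measurable_pi_lambda _ hX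
  have hY' : Measurable fun ω n => Y n ω := measurable_pi_lambda _ hY
  have hv' : Measurable v := funext (hv 0) ▸ measurable_lintegral_expNeg_mark (hY 0) hH
  have hG : Measurable fun q : (ℕ → E) × (ℕ → F) =>
      ∏ n ∈ Finset.range N, expNeg (H (q.1 n) (q.2 n)) :=
    Finset.measurable_fun_prod _ fun n _ => measurable_expNeg.comp
      (hH.comp (f := fun q : (ℕ → E) × (ℕ → F) => (q.1 n, q.2 n))
      (((measurable_pi_apply n).comp measurable_fst).prodMk
        ((measurable_pi_apply n).comp measurable_snd)))
  have h1 := (indepFun_iff_map_prod_eq_prod_map_map hX'.aemeasurable hY'.aemeasurable).1 hXY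
  have h2 := lintegral_map (μ := P) hG (hX'.prodMk hY')
  rw [← h2, h1, lintegral_prod _ hG.aemeasurable]
  have h3 : ∀ x : ℕ → E, ∫⁻ y, ∏ n ∈ Finset.range N, expNeg (H (x n) (y n))
      ∂(P.map fun ω n => Y n ω) = ∏ n ∈ Finset.range N, v (x n) := by
    intro x
    have hm : ∀ n, Measurable fun y : F => expNeg (H (x n) y) := fun n =>
      measurable_expNeg.comp (hH.comp measurable_prodMk_left)
    rw [lintegral_map (f := fun y : ℕ → F => ∏ n ∈ Finset.range N, expNeg (H (x n) (y n)))
        (hG.comp measurable_prodMk_left) hY', lintegral_prod_eq_prod_lintegral_of_indepFun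
        (Finset.range N) (fun n ω => expNeg (H (x n) (Y n ω)))
        (hYi.comp (fun n y => expNeg (H (x n) y)) hm) (fun n => (hm n).comp (hY n))]
    exact Finset.prod_congr rfl fun n _ => hv n (x n)
  simp_rw [h3]
  rw [lintegral_map _ hX']
  exact Finset.measurable_fun_prod _ fun n _ => hv'.comp (measurable_pi_apply n)

/-- The Laplace functional of an independently marked Poisson process. Once the marks are averaged
out, the sum over the marked points has the same Laplace functional as the sum of `-log v` over the
points. -/
theorem IsPoissonProcess.lintegral_expNeg_marked [IsProbabilityMeasure P] {Λ : Measure E}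
    [SigmaFinite Λ] (hX : IsPoissonProcess X Λ P)
    (hY : ∀ n, Measurable (Y n)) (hXY : IndepFun (fun ω n => X n ω) (fun ω n => Y n ω) P)
    (hYi : iIndepFun Y P) {H : E → F → ℝ≥0∞} (hH : Measurable (Function.uncurry H))
    {v : E → ℝ≥0∞} (hv : ∀ n x, ∫⁻ ω, expNeg (H x (Y n ω)) ∂P = v x) :
    ∫⁻ ω, expNeg (∑' n, H (X n ω) (Y n ω)) ∂P = expNeg (∫⁻ x, (1 - v x) ∂Λ) := by
  obtain ⟨l, hl, hlv⟩ := exists_measurable_expNeg_eq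
  have hv' : Measurable v := funext (hv 0) ▸ measurable_lintegral_expNeg_mark (hY 0) hH
  have hv1 : ∀ x, v x ≤ 1 := fun x => by
    rw [← hv 0 x]
    exact (lintegral_mono fun ω => expNeg_le_one _).trans (by simp)
  have hm : ∀ n, Measurable fun ω => expNeg (H (X n ω) (Y n ω)) := fun n =>
    measurable_expNeg.comp (hH.comp ((hX.measurable n).prodMk (hY n)))
  have hle : ∀ (f : ℕ → ℝ≥0∞) (N : ℕ), ∏ n ∈ Finset.range N, expNeg (f n) ≤ 1 := fun f N =>
    Finset.prod_le_one' fun n _ => expNeg_le_one _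
  have key := hX.lintegral_expNeg_tsum (hl.comp hv')
  simp only [Function.comp_apply, fun x => hlv _ (hv1 x)] at key
  rw [← key]
  have hleft : Tendsto (fun N => ∫⁻ ω, ∏ n ∈ Finset.range N, expNeg (H (X n ω) (Y n ω)) ∂P) atTop
      (𝓝 (∫⁻ ω, expNeg (∑' n, H (X n ω) (Y n ω)) ∂P)) :=
    tendsto_lintegral_of_dominated_convergence (fun _ => 1)
      (fun N => Finset.measurable_fun_prod _ fun n _ => hm n)
      (fun N => ae_of_all _ fun ω => hle _ N) (by simp)
      (ae_of_all _ fun ω => tendsto_prod_expNeg _)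
  have hright : Tendsto (fun N => ∫⁻ ω, ∏ n ∈ Finset.range N, expNeg (l (v (X n ω))) ∂P) atTop
      (𝓝 (∫⁻ ω, expNeg (∑' n, l (v (X n ω))) ∂P)) :=
    tendsto_lintegral_of_dominated_convergence (fun _ => 1)
      (fun N => Finset.measurable_fun_prod _ fun n _ =>
        measurable_expNeg.comp ((hl.comp hv').comp (hX.measurable n)))
      (fun N => ae_of_all _ fun ω => hle _ N) (by simp)
      (ae_of_all _ fun ω => tendsto_prod_expNeg _)
  refine tendsto_nhds_unique (hleft.congr fun N => ?_) hright
  rw [lintegral_prod_expNeg_marked hX.measurable hY hXY hYi hH hv N]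
  simp_rw [fun x => hlv _ (hv1 x)]

/-- Random variables that depend on pairwise disjoint groups of independent sources are
independent. -/
lemma iIndepFun_of_disjoint_groups [IsProbabilityMeasure P] {ι : Type*} {m : ι → MeasurableSpace Ω}
    (hle : ∀ i, m i ≤ mΩ) (h : iIndep m P) {S : ℕ → Set ι}
    (hS : ∀ a b, a ≠ b → Disjoint (S a) (S b))
    (hY : ∀ n, Measurable[⨆ i ∈ S n, m i] (Y n)) : iIndepFun Y P := by
  classical
  rw [iIndepFun_iff_measure_inter_preimage_eq_mul]
  intro T
  induction T using Finset.induction_on with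
  | empty => simp
  | insert a T ha ih =>
    intro B hB
    rw [Finset.prod_insert ha, Finset.set_biInter_insert,
      ← ih fun i hi => hB i (Finset.mem_insert_of_mem hi)]
    have hdisj : Disjoint (S a) (⋃ b ∈ T, S b) := by
      rw [Set.disjoint_iUnion₂_right]
      exact fun b hb => hS a b fun hab => ha (hab ▸ hb)
    refine (Indep_iff _ _ _).1 (indep_iSup_of_disjoint hle h hdisj) _ _
      (hY a (hB a (Finset.mem_insert_self a T))) ?_
    refine Finset.measurableSet_biInter T fun b hb => ?_
    have : (⨆ i ∈ S b, m i) ≤ ⨆ i ∈ ⋃ b ∈ T, S b, m i :=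
      biSup_mono fun i hi => Set.mem_biUnion hb hi
    exact this _ (hY b (hB b (Finset.mem_insert_of_mem hb)))

end Marks

/-! ### Functionals of the network -/

/-- `measurable_pi_lambda` for a σ-algebra that is not the ambient one. -/
lemma measurable_pi_of {α ι : Type*} {π : ι → Type*} {m : MeasurableSpace α}
    [∀ i, MeasurableSpace (π i)] {f : α → ∀ i, π i} (h : ∀ i, Measurable fun a => f a i) :
    Measurable f := measurable_pi_lambda f h

/-- `Measurable.tsum` for a σ-algebra that is not the ambient one. -/
lemma measurable_tsum_of {α : Type*} {m : MeasurableSpace α} {f : ℕ → α → ℝ≥0∞}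
    (h : ∀ i, Measurable (f i)) : Measurable fun a => ∑' i, f i a := Measurable.tsum h

namespace Network

variable {p : Params} {Ω : Type*} [mΩ : MeasurableSpace Ω] {P : Measure Ω} (N : Network p P)

/-- The σ-algebra generated by a source of randomness. -/
@[reducible] def sourceAlgebra : Source → MeasurableSpace Ω
  | .roads => MeasurableSpace.comap (fun ω n => N.road n ω) inferInstance
  | .nodes k => MeasurableSpace.comap (fun ω j => N.node k j ω) inferInstance
  | .stations => MeasurableSpace.comap (fun ω n => N.station n ω) inferInstance
  | .gain k j => MeasurableSpace.comap (N.gain k j) inferInstance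
  | .linkGain => MeasurableSpace.comap N.linkGain inferInstance

lemma iIndep_sourceAlgebra : iIndep N.sourceAlgebra P := by
  exact (congrArg (iIndep · P) (funext fun s => by cases s <;> rfl)).mpr N.indep

lemma measurable_road (n : ℕ) : Measurable (N.road n) := N.road_poisson.measurable n

lemma measurable_node (k : Option ℕ) (j : ℕ) : Measurable (N.node k j) :=
  (N.node_poisson k).measurable j

lemma measurable_station (n : ℕ) : Measurable (N.station n) := N.station_poisson.measurable n

lemma sourceAlgebra_le (s : Source) : N.sourceAlgebra s ≤ mΩ := by
  cases s with
  | roads => exact (measurable_pi_lambda _ N.measurable_road).comap_le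
  | nodes k => exact (measurable_pi_lambda _ (N.measurable_node k)).comap_le
  | stations => exact (measurable_pi_lambda _ N.measurable_station).comap_le
  | gain k j => exact (N.gain_measurable k j).comap_le
  | linkGain => exact N.linkGain_measurable.comap_le

/-- The σ-algebra generated by a set of sources of randomness. -/
@[reducible] def algebraOf (S : Set Source) : MeasurableSpace Ω := ⨆ s ∈ S, N.sourceAlgebra s

lemma sourceAlgebra_le_algebraOf {S : Set Source} {s : Source} (h : s ∈ S) :
    N.sourceAlgebra s ≤ N.algebraOf S := le_biSup N.sourceAlgebra h

lemma indepFun_of_disjoint {β γ : Type*} [MeasurableSpace β] [MeasurableSpace γ] {S T : Set Source}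
    (hST : Disjoint S T) {f : Ω → β} {g : Ω → γ} (hf : Measurable[N.algebraOf S] f)
    (hg : Measurable[N.algebraOf T] g) : IndepFun f g P := by
  rw [IndepFun_iff_Indep]
  exact indep_of_indep_of_le_left (indep_of_indep_of_le_right
    (indep_iSup_of_disjoint N.sourceAlgebra_le N.iIndep_sourceAlgebra hST) hg.comap_le) hf.comap_le

lemma measurable_algebraOf_roads {S : Set Source} (h : .roads ∈ S) (n : ℕ) :
    Measurable[N.algebraOf S] (N.road n) := by
  refine Measurable.mono (measurable_pi_apply (X := fun _ => ℝ × ℝ) n |>.comp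
    (comap_measurable fun ω n => N.road n ω)) (N.sourceAlgebra_le_algebraOf h) le_rfl

lemma measurable_algebraOf_nodes {S : Set Source} {k : Option ℕ} (h : .nodes k ∈ S) (j : ℕ) :
    Measurable[N.algebraOf S] (N.node k j) := by
  refine Measurable.mono (measurable_pi_apply (X := fun _ => ℝ) j |>.comp
    (comap_measurable fun ω j => N.node k j ω)) (N.sourceAlgebra_le_algebraOf h) le_rfl

lemma measurable_algebraOf_stations {S : Set Source} (h : .stations ∈ S) (n : ℕ) :
    Measurable[N.algebraOf S] (N.station n) := by
  refine Measurable.mono (measurable_pi_apply (X := fun _ => EuclideanSpace ℝ (Fin 2)) n |>.comp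
    (comap_measurable fun ω n => N.station n ω)) (N.sourceAlgebra_le_algebraOf h) le_rfl

lemma measurable_algebraOf_gain {S : Set Source} {k : Option ℕ} {j : ℕ} (h : .gain k j ∈ S) :
    Measurable[N.algebraOf S] (N.gain k j) :=
  Measurable.mono (comap_measurable _) (N.sourceAlgebra_le_algebraOf h) le_rfl

lemma measurable_algebraOf_linkGain {S : Set Source} (h : .linkGain ∈ S) :
    Measurable[N.algebraOf S] N.linkGain :=
  Measurable.mono (comap_measurable _) (N.sourceAlgebra_le_algebraOf h) le_rfl

end Network

/-- The exponent of the Laplace functional of the marked nodes of a road `L`, for a function `H`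
of the road, the coordinate of a node on it, and the gain of the node. -/
def Params.lineExponent (p : Params) (H : ℝ × ℝ → ℝ → ℝ → ℝ≥0∞) (L : ℝ × ℝ) : ℝ≥0∞ :=
  ENNReal.ofReal p.muv * ∫⁻ t, (1 - ∫⁻ g, expNeg (H L t g) ∂(expMeasure 1))

instance {E : Type*} [MeasurableSpace E] (Λ : Measure E) [SigmaFinite Λ] (a : ℝ) :
    SigmaFinite (ENNReal.ofReal a • Λ) :=
  inferInstanceAs (SigmaFinite (a.toNNReal • Λ))

namespace Network

variable {p : Params} {Ω : Type*} [mΩ : MeasurableSpace Ω] {P : Measure Ω} (N : Network p P)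

/-- The sum of `H` over the nodes on the road `k`, if this road is the line `L`. -/
def lineSum (H : ℝ × ℝ → ℝ → ℝ → ℝ≥0∞) (k : Option ℕ) (L : ℝ × ℝ) (ω : Ω) : ℝ≥0∞ :=
  ∑' j, H L (N.node k j ω) (N.gain k j ω)

/-- The sum of `H` over all nodes of the network. -/
def totalSum (H : ℝ × ℝ → ℝ → ℝ → ℝ≥0∞) (ω : Ω) : ℝ≥0∞ :=
  N.lineSum H none (N.line none ω) ω + ∑' i, N.lineSum H (some i) (N.line (some i) ω) ω

/-- The sources of randomness on the road `k`. -/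
def roadSources (k : Option ℕ) : Set Source := {.nodes k} ∪ range (Source.gain k)

variable {H : ℝ × ℝ → ℝ → ℝ → ℝ≥0∞}

lemma lintegral_expNeg_lineSum [IsProbabilityMeasure P]
    (hH : Measurable fun q : (ℝ × ℝ) × ℝ × ℝ => H q.1 q.2.1 q.2.2)
    (k : Option ℕ) (L : ℝ × ℝ) :
    ∫⁻ ω, expNeg (N.lineSum H k L ω) ∂P = expNeg (p.lineExponent H L) := by
  have hHL : Measurable (Function.uncurry (H L)) := hH.comp measurable_prodMk_left
  have hXY : IndepFun (fun ω j => N.node k j ω) (fun ω j => N.gain k j ω) P := by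
    refine N.indepFun_of_disjoint (S := {.nodes k}) (T := range (Source.gain k)) ?_ ?_ ?_
    · simp
    · exact measurable_pi_of fun j => N.measurable_algebraOf_nodes (by simp) j
    · exact measurable_pi_of fun j => N.measurable_algebraOf_gain (by simp)
  have hYi : iIndepFun (N.gain k) P := by
    refine iIndepFun_of_disjoint_groups N.sourceAlgebra_le N.iIndep_sourceAlgebra
      (S := fun j => {Source.gain k j}) (fun a b hab => ?_) fun j =>
        N.measurable_algebraOf_gain (S := {Source.gain k j}) (by simp)
    simpa using hab
  have := (N.node_poisson k).lintegral_expNeg_marked (N.gain_measurable k) hXY hYi hHL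
    (v := fun t => ∫⁻ g, expNeg (H L t g) ∂(expMeasure 1)) fun j t =>
      (N.gain_law k j).lintegral_comp (f := fun g => expNeg (H L t g))
        (measurable_expNeg.comp (hHL.comp measurable_prodMk_left)).aemeasurable
  rw [lintegral_smul_measure] at this
  exact this

lemma measurable_lineSum_prod
    (hH : Measurable fun q : (ℝ × ℝ) × ℝ × ℝ => H q.1 q.2.1 q.2.2)
    (S : Set Source) (k : Option ℕ) (hS : roadSources k ⊆ S)
    {f : Ω → ℝ × ℝ} (hf : Measurable[N.algebraOf S] f) :
    Measurable[N.algebraOf S] fun ω => N.lineSum H k (f ω) ω := by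
  refine measurable_tsum_of fun j => hH.comp (hf.prodMk (Measurable.prodMk ?_ ?_))
  · exact N.measurable_algebraOf_nodes (hS (by simp [roadSources])) j
  · exact N.measurable_algebraOf_gain (hS (by simp [roadSources]))

/-- The sources of randomness of the roads, the nodes and their gains. -/
def vehicleSources : Set Source := {.roads} ∪ ⋃ k, roadSources k

lemma measurable_totalSum
    (hH : Measurable fun q : (ℝ × ℝ) × ℝ × ℝ => H q.1 q.2.1 q.2.2) :
    Measurable[N.algebraOf vehicleSources] (N.totalSum H) := by
  have hsub : ∀ k, roadSources k ⊆ vehicleSources := fun k =>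
    (subset_iUnion roadSources k).trans subset_union_right
  refine Measurable.add (N.measurable_lineSum_prod hH _ none (hsub none) measurable_const)
    (measurable_tsum_of fun i => N.measurable_lineSum_prod hH _ (some i) (hsub _)
      (N.measurable_algebraOf_roads (by simp [vehicleSources]) i))

/-- The Laplace functional of the marked Cox process of all nodes. The sum over the nodes of a road
is a mark of that road, so that the Laplace functional is that of a Poisson line process whose marks
are themselves functionals of Poisson processes. -/
theorem lintegral_expNeg_totalSum [IsProbabilityMeasure P]
    (hH : Measurable fun q : (ℝ × ℝ) × ℝ × ℝ => H q.1 q.2.1 q.2.2) :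
    ∫⁻ ω, expNeg (N.totalSum H ω) ∂P =
      expNeg (p.lineExponent H (p.theta0, 0)) *
        expNeg (ENNReal.ofReal p.lamR * ∫⁻ L, (1 - expNeg (p.lineExponent H L))
          ∂((volume.restrict (Icc (0 : ℝ) Real.pi)).prod volume)) := by
  have hle : ∀ S, N.algebraOf S ≤ mΩ := fun S => iSup₂_le fun s _ => N.sourceAlgebra_le s
  -- the marks of the roads
  let Y : ℕ → Ω → (ℕ → ℝ) × (ℕ → ℝ) := fun i ω =>
    (fun j => N.node (some i) j ω, fun j => N.gain (some i) j ω)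
  let W : ℝ × ℝ → (ℕ → ℝ) × (ℕ → ℝ) → ℝ≥0∞ := fun L y => ∑' j, H L (y.1 j) (y.2 j)
  have hYm : ∀ i S, roadSources (some i) ⊆ S → Measurable[N.algebraOf S] (Y i) := by
    intro i S hS
    refine Measurable.prodMk (measurable_pi_of fun j => ?_)
      (measurable_pi_of fun j => ?_)
    · exact N.measurable_algebraOf_nodes (hS (by simp [roadSources])) j
    · exact N.measurable_algebraOf_gain (hS (by simp [roadSources]))
  have hW : Measurable (Function.uncurry W) := by
    refine measurable_tsum_of fun j => hH.comp (measurable_fst.prodMk (Measurable.prodMk ?_ ?_))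
    · exact (measurable_pi_apply j).comp (measurable_fst.comp measurable_snd)
    · exact (measurable_pi_apply j).comp (measurable_snd.comp measurable_snd)
  have hdisj : ∀ a b : Option ℕ, a ≠ b → Disjoint (roadSources a) (roadSources b) := by
    intro a b hab
    rw [Set.disjoint_left]
    rintro s (rfl | ⟨j, rfl⟩) (hs | ⟨i, hs⟩)
    · exact hab (by simpa using hs)
    · simp at hs
    · simp at hs
    · simp only [Source.gain.injEq] at hs
      exact hab hs.1.symm
  have hXY : IndepFun (fun ω n => N.road n ω) (fun ω i => Y i ω) P := by
    refine N.indepFun_of_disjoint (S := {.roads}) (T := ⋃ i : ℕ, roadSources (some i)) ?_ ?_ ?_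
    · simp [roadSources]
    · exact measurable_pi_of fun n => N.measurable_algebraOf_roads (by simp) n
    · exact measurable_pi_of fun i => hYm i _ (subset_iUnion_of_subset i subset_rfl)
  have hYi : iIndepFun Y P :=
    iIndepFun_of_disjoint_groups N.sourceAlgebra_le N.iIndep_sourceAlgebra
      (S := fun i => roadSources (some i)) (fun a b hab => hdisj _ _ (by simpa using hab))
      fun i => hYm i _ subset_rfl
  have hroads := N.road_poisson.lintegral_expNeg_marked
    (fun i => (hYm i _ subset_rfl).mono (hle _) le_rfl) hXY hYi hW
    (v := fun L => expNeg (p.lineExponent H L)) fun i L => N.lintegral_expNeg_lineSum hH (some i) L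
  rw [lintegral_smul_measure] at hroads
  rw [← N.lintegral_expNeg_lineSum hH none, ← smul_eq_mul (ENNReal.ofReal p.lamR), ← hroads]
  simp_rw [totalSum, expNeg_add]
  have h1 : Measurable[N.algebraOf (roadSources none)] fun ω =>
      N.lineSum H none (p.theta0, 0) ω :=
    N.measurable_lineSum_prod hH _ none subset_rfl measurable_const
  have h2 : Measurable[N.algebraOf ({.roads} ∪ ⋃ i : ℕ, roadSources (some i))] fun ω =>
      ∑' i, N.lineSum H (some i) (N.line (some i) ω) ω :=
    measurable_tsum_of fun i => N.measurable_lineSum_prod hH _ (some i)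
      ((subset_iUnion (fun i : ℕ => roadSources (some i)) i).trans subset_union_right)
      (N.measurable_algebraOf_roads (by simp) i)
  refine lintegral_mul_eq_lintegral_mul_lintegral_of_indepFun
    (measurable_expNeg.comp (h1.mono (hle _) le_rfl))
    (measurable_expNeg.comp (h2.mono (hle _) le_rfl))
    ((N.indepFun_of_disjoint ?_ h1 h2).comp measurable_expNeg measurable_expNeg)
  rw [Set.disjoint_union_right, Set.disjoint_iUnion_right]
  exact ⟨by simp [roadSources], fun i => hdisj _ _ (by simp)⟩

end Network

/-! ### Laws on the half-line from their tails -/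

/-- If `Φ` is an antiderivative of `φ`, then `r ↦ φ r * exp (-Φ r)` integrates to the tail
`exp (-Φ r)`. -/
lemma integrableOn_and_setLIntegral_Ioi_mul_exp_neg {Φ φ : ℝ → ℝ} (hc : ContinuousOn Φ (Ici 0))
    (hd : ∀ r, 0 < r → HasDerivAt Φ (φ r) r) (hφ : ∀ r, 0 < r → 0 ≤ φ r)
    (hlim : Tendsto Φ atTop atTop) {r : ℝ} (hr : 0 ≤ r) :
    IntegrableOn (fun x => φ x * Real.exp (-Φ x)) (Ioi r) ∧
      ∫⁻ x in Ioi r, ENNReal.ofReal (φ x * Real.exp (-Φ x)) =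
        ENNReal.ofReal (Real.exp (-Φ r)) := by
  have hcont : ContinuousWithinAt (fun x => -Real.exp (-Φ x)) (Ici r) r :=
    (((hc r hr).mono (Ici_subset_Ici.2 hr)).neg.rexp).neg
  have hderiv : ∀ x ∈ Ioi r, HasDerivAt (fun x => -Real.exp (-Φ x)) (φ x * Real.exp (-Φ x)) x := by
    intro x hx
    have h : HasDerivAt (fun x => -Φ x) (-φ x) x := (hd x (hr.trans_lt hx)).neg
    convert! h.exp.neg using 1
    ring
  have hpos : ∀ x ∈ Ioi r, 0 ≤ φ x * Real.exp (-Φ x) := fun x hx =>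
    mul_nonneg (hφ x (hr.trans_lt hx)) (Real.exp_nonneg _)
  have hl : Tendsto (fun x => -Real.exp (-Φ x)) atTop (𝓝 0) := by
    simpa using (Real.tendsto_exp_neg_atTop_nhds_zero.comp hlim).neg
  have hint := integrableOn_Ioi_deriv_of_nonneg hcont hderiv hpos hl
  refine ⟨hint, ?_⟩
  rw [← ofReal_integral_eq_lintegral_ofReal hint
    ((ae_restrict_iff' measurableSet_Ioi).2 (ae_of_all _ hpos)),
    integral_Ioi_of_hasDerivAt_of_nonneg hcont hderiv hpos hl]
  simp

/-- A nonnegative random variable with tail `exp (-Φ r)` has density `φ r * exp (-Φ r)`, where `φ`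
is the derivative of `Φ`. -/
lemma hasLaw_of_tail {Ω : Type*} [MeasurableSpace Ω] {P : Measure Ω} [IsProbabilityMeasure P]
    {X : Ω → ℝ} (hX : Measurable X) (h0 : ∀ ω, 0 ≤ X ω) {Φ φ : ℝ → ℝ} (hΦ0 : Φ 0 = 0)
    (hc : ContinuousOn Φ (Ici 0)) (hd : ∀ r, 0 < r → HasDerivAt Φ (φ r) r)
    (hφ : ∀ r, 0 < r → 0 ≤ φ r) (hlim : Tendsto Φ atTop atTop)
    (htail : ∀ r, 0 < r → P {ω | r ≤ X ω} = ENNReal.ofReal (Real.exp (-Φ r))) :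
    HasLaw X ((volume.restrict (Ioi (0 : ℝ))).withDensity
      fun r => ENNReal.ofReal (φ r * Real.exp (-Φ r))) P := by
  refine ⟨hX.aemeasurable, ?_⟩
  have := Measure.isProbabilityMeasure_map (μ := P) hX.aemeasurable
  refine Measure.ext_of_Ici _ _ fun r => ?_
  rw [Measure.map_apply hX measurableSet_Ici, withDensity_apply _ measurableSet_Ici,
    Measure.restrict_restrict measurableSet_Ici]
  rcases lt_or_ge 0 r with hr | hr
  · rw [inter_eq_left.2 (Ici_subset_Ioi.2 hr), setLIntegral_congr Ioi_ae_eq_Ici.symm,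
      (integrableOn_and_setLIntegral_Ioi_mul_exp_neg hc hd hφ hlim hr.le).2]
    exact htail r hr
  · rw [inter_eq_right.2 ((Ioi_subset_Ioi hr).trans Ioi_subset_Ici_self),
      (integrableOn_and_setLIntegral_Ioi_mul_exp_neg hc hd hφ hlim le_rfl).2, hΦ0,
      show X ⁻¹' Ici r = univ from eq_univ_of_forall fun ω => hr.trans (h0 ω)]
    simp

/-! ### The void exponent -/

/-- The substitution `y = r sin φ`. -/
lemma integral_comp_mul_sin {r : ℝ} (hr : 0 < r) (g : ℝ → ℝ) :
    ∫ y in (0 : ℝ)..r, g y =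
      ∫ φ in (0 : ℝ)..(Real.pi / 2), r * Real.cos φ * g (r * Real.sin φ) := by
  have hpi := Real.pi_pos
  have hinj : InjOn (fun φ => r * Real.sin φ) (Ioo 0 (Real.pi / 2)) := fun a ha b hb hab =>
    Real.injOn_sin ⟨by linarith [ha.1], ha.2.le⟩ ⟨by linarith [hb.1], hb.2.le⟩
      (mul_left_cancel₀ hr.ne' hab)
  have himg : (fun φ => r * Real.sin φ) '' Ioo 0 (Real.pi / 2) = Ioo 0 r := by
    ext y
    constructor
    · rintro ⟨φ, hφ, rfl⟩
      have h1 := Real.sin_pos_of_pos_of_lt_pi hφ.1 (by linarith [hφ.2])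
      have h2 : Real.sin φ < Real.sin (Real.pi / 2) :=
        Real.sin_lt_sin_of_lt_of_le_pi_div_two (by linarith [hφ.1]) le_rfl hφ.2
      rw [Real.sin_pi_div_two] at h2
      exact ⟨by positivity, by nlinarith⟩
    · rintro ⟨h0, h1⟩
      have h2 : y / r < 1 := (div_lt_one hr).2 h1
      have h3 : 0 < y / r := by positivity
      refine ⟨Real.arcsin (y / r), ⟨Real.arcsin_pos.2 h3, Real.arcsin_lt_pi_div_two.2 h2⟩, ?_⟩
      simp only
      rw [Real.sin_arcsin (by linarith) h2.le]
      field_simp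
  rw [intervalIntegral.integral_of_le hr.le, intervalIntegral.integral_of_le (by linarith),
    integral_Ioc_eq_integral_Ioo, integral_Ioc_eq_integral_Ioo, ← himg,
    integral_image_eq_integral_abs_deriv_smul (f' := fun φ => r * Real.cos φ) measurableSet_Ioo
      (fun φ _ => ((Real.hasDerivAt_sin φ).const_mul r).hasDerivWithinAt) hinj]
  refine setIntegral_congr_fun measurableSet_Ioo fun φ hφ => ?_
  have := Real.cos_pos_of_mem_Ioo ⟨by linarith [hφ.1], hφ.2⟩
  simp only [smul_eq_mul]
  rw [abs_of_pos (by positivity)]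

/-- The chord at distance `y = r sin φ` has half-length `r cos φ`. -/
lemma sqrt_sq_sub_mul_sin_sq {r φ : ℝ} (hr : 0 ≤ r) (hφ : 0 ≤ Real.cos φ) :
    Real.sqrt (r ^ 2 - (r * Real.sin φ) ^ 2) = r * Real.cos φ := by
  rw [show r ^ 2 - (r * Real.sin φ) ^ 2 = (r * Real.cos φ) ^ 2 by
    linear_combination (-r ^ 2) * Real.sin_sq_add_cos_sq φ, Real.sqrt_sq (by positivity)]

/-- Differentiation of the integral in the void exponent after the substitution `y = r sin φ`. The
derivative of the integrand and the stated integrand differ by the derivative of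
`sin φ * (1 - exp (-c r cos φ))`, which vanishes at both ends. -/
lemma hasDerivAt_integral_cos_mul_one_sub_exp (c r : ℝ) :
    HasDerivAt (fun r => ∫ φ in (0 : ℝ)..(Real.pi / 2),
        r * Real.cos φ * (1 - Real.exp (-c * (r * Real.cos φ))))
      (∫ φ in (0 : ℝ)..(Real.pi / 2), c * r * Real.exp (-c * (r * Real.cos φ))) r := by
  let F' : ℝ → ℝ → ℝ := fun x φ => Real.cos φ * (1 - Real.exp (-c * (x * Real.cos φ))) +
    x * Real.cos φ * (c * Real.cos φ * Real.exp (-c * (x * Real.cos φ)))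
  -- the derivative is jointly continuous, hence bounded near `r`
  obtain ⟨C, hC⟩ := ((isCompact_closedBall r 1).prod (isCompact_uIcc (a := (0 : ℝ))
    (b := Real.pi / 2))).exists_bound_of_continuousOn (f := fun q : ℝ × ℝ => F' q.1 q.2)
    (by fun_prop)
  have hd : ∀ x φ, HasDerivAt
      (fun x => x * Real.cos φ * (1 - Real.exp (-c * (x * Real.cos φ)))) (F' x φ) x := by
    intro x φ
    have h1 : HasDerivAt (fun x : ℝ => x * Real.cos φ) (Real.cos φ) x := by
      simpa using (hasDerivAt_id x).mul_const (Real.cos φ)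
    have h2 := h1.mul ((h1.const_mul (-c)).exp.const_sub 1)
    convert! h2 using 1
    simp only [F']
    ring
  have h := (intervalIntegral.hasDerivAt_integral_of_dominated_loc_of_deriv_le
    (F := fun x φ => x * Real.cos φ * (1 - Real.exp (-c * (x * Real.cos φ)))) (F' := F')
    (μ := volume) (a := 0) (b := Real.pi / 2) (bound := fun _ => C)
    (Metric.ball_mem_nhds r one_pos)
    (Eventually.of_forall fun x => Continuous.aestronglyMeasurable (by fun_prop))
    (Continuous.intervalIntegrable (by fun_prop) _ _)
    (Continuous.aestronglyMeasurable (by fun_prop))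
    (ae_of_all _ fun φ hφ x hx => hC (x, φ) ⟨Metric.ball_subset_closedBall hx,
      uIoc_subset_uIcc hφ⟩)
    (by simp) (ae_of_all _ fun φ _ x _ => hd x φ)).2
  convert! h using 1
  have hparts : ∫ φ in (0 : ℝ)..(Real.pi / 2),
      (F' r φ - c * r * Real.exp (-c * (r * Real.cos φ))) = 0 := by
    rw [intervalIntegral.integral_eq_sub_of_hasDerivAt
      (f := fun φ => Real.sin φ * (1 - Real.exp (-c * (r * Real.cos φ))))]
    · simp
    · intro φ _
      have h1 := (Real.hasDerivAt_sin φ).mul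
        ((((Real.hasDerivAt_cos φ).const_mul r).const_mul (-c)).exp.const_sub 1)
      convert! h1 using 1
      simp only [F']
      linear_combination (c * r * Real.exp (-c * (r * Real.cos φ))) * Real.sin_sq_add_cos_sq φ
    · exact Continuous.intervalIntegrable (by fun_prop) _ _
  rw [intervalIntegral.integral_sub (Continuous.intervalIntegrable (by fun_prop) _ _)
    (Continuous.intervalIntegrable (by fun_prop) _ _)] at hparts
  linarith

namespace Params

variable (p : Params)

lemma voidExponent_eq {r : ℝ} (hr : 0 ≤ r) :
    p.voidExponent r = 2 * Real.pi * p.lamR * (∫ φ in (0 : ℝ)..(Real.pi / 2),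
      r * Real.cos φ * (1 - Real.exp (-(2 * p.muv) * (r * Real.cos φ)))) + 2 * p.muv * r := by
  rcases hr.eq_or_lt with rfl | hr
  · simp [voidExponent]
  rw [voidExponent, integral_comp_mul_sin hr]
  congr 2
  refine intervalIntegral.integral_congr fun φ hφ => ?_
  rw [uIcc_of_le (by positivity)] at hφ
  have := Real.cos_nonneg_of_mem_Icc ⟨by linarith [hφ.1, Real.pi_pos], hφ.2⟩
  simp only [sqrt_sq_sub_mul_sin_sq hr.le this, neg_mul]

/-- The factor in front of the exponential in the density of the V2V distance. -/
def voidRate (r : ℝ) : ℝ :=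
  4 * Real.pi * p.lamR * p.muv *
    (∫ y in (0 : ℝ)..r, r * Real.exp (-2 * p.muv * Real.sqrt (r ^ 2 - y ^ 2)) /
      Real.sqrt (r ^ 2 - y ^ 2)) + 2 * p.muv

lemma voidRate_eq {r : ℝ} (hr : 0 < r) :
    p.voidRate r = 2 * Real.pi * p.lamR * (∫ φ in (0 : ℝ)..(Real.pi / 2),
      2 * p.muv * r * Real.exp (-(2 * p.muv) * (r * Real.cos φ))) + 2 * p.muv := by
  rw [voidRate, integral_comp_mul_sin hr]
  have : ∀ φ ∈ Ioo (0 : ℝ) (Real.pi / 2),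
      2 * p.muv * (r * Real.cos φ * (r * Real.exp (-2 * p.muv *
        Real.sqrt (r ^ 2 - (r * Real.sin φ) ^ 2)) / Real.sqrt (r ^ 2 - (r * Real.sin φ) ^ 2))) =
      2 * p.muv * r * Real.exp (-(2 * p.muv) * (r * Real.cos φ)) := by
    intro φ hφ
    have := Real.cos_pos_of_mem_Ioo ⟨by linarith [hφ.1, Real.pi_pos], hφ.2⟩
    rw [sqrt_sq_sub_mul_sin_sq hr.le this.le]
    field_simp
  have hpi : (0 : ℝ) ≤ Real.pi / 2 := by positivity
  have h2 := setIntegral_congr_fun (μ := volume) measurableSet_Ioo this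
  rw [integral_const_mul, ← integral_Ioc_eq_integral_Ioo, ← integral_Ioc_eq_integral_Ioo,
    ← intervalIntegral.integral_of_le hpi, ← intervalIntegral.integral_of_le hpi] at h2
  rw [← h2]
  ring

lemma continuousOn_voidExponent : ContinuousOn p.voidExponent (Ici 0) := by
  refine ContinuousOn.congr (fun r _ => ?_) fun r hr => p.voidExponent_eq hr
  exact (((hasDerivAt_integral_cos_mul_one_sub_exp _ r).continuousAt.const_mul _).add
    (continuousAt_const.mul continuousAt_id)).continuousWithinAt

lemma hasDerivAt_voidExponent {r : ℝ} (hr : 0 < r) :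
    HasDerivAt p.voidExponent (p.voidRate r) r := by
  rw [p.voidRate_eq hr]
  have h := ((hasDerivAt_integral_cos_mul_one_sub_exp (2 * p.muv) r).const_mul
    (2 * Real.pi * p.lamR)).add ((hasDerivAt_id r).const_mul (2 * p.muv))
  rw [mul_one] at h
  refine h.congr_of_eventuallyEq ?_
  filter_upwards [lt_mem_nhds hr] with x hx
  exact p.voidExponent_eq hx.le

lemma voidRate_nonneg {r : ℝ} (hr : 0 < r) : 0 ≤ p.voidRate r := by
  have h1 := p.lamR_pos
  have h2 := p.muv_pos
  rw [voidRate]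
  have : 0 ≤ ∫ y in (0 : ℝ)..r, r * Real.exp (-2 * p.muv * Real.sqrt (r ^ 2 - y ^ 2)) /
      Real.sqrt (r ^ 2 - y ^ 2) :=
    intervalIntegral.integral_nonneg hr.le fun y _ => by positivity
  positivity

lemma integral_one_sub_exp_sqrt_nonneg {r : ℝ} (hr : 0 ≤ r) :
    0 ≤ ∫ y in (0 : ℝ)..r, (1 - Real.exp (-2 * p.muv * Real.sqrt (r ^ 2 - y ^ 2))) := by
  refine intervalIntegral.integral_nonneg hr fun y _ => ?_
  rw [sub_nonneg, Real.exp_le_one_iff, neg_mul, neg_mul, neg_nonpos]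
  have := p.muv_pos
  positivity

lemma le_voidExponent {r : ℝ} (hr : 0 ≤ r) : 2 * p.muv * r ≤ p.voidExponent r := by
  have h1 := p.lamR_pos
  have := p.integral_one_sub_exp_sqrt_nonneg hr
  rw [voidExponent, le_add_iff_nonneg_left]
  positivity

lemma tendsto_voidExponent : Tendsto p.voidExponent atTop atTop := by
  have h2 := p.muv_pos
  refine tendsto_atTop_mono' _ ?_ (tendsto_id.const_mul_atTop (r := 2 * p.muv) (by positivity))
  filter_upwards [eventually_ge_atTop 0] with r hr using p.le_voidExponent hr

lemma pdfRv_nonneg {r : ℝ} (hr : 0 < r) : 0 ≤ p.pdfRv r :=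
  mul_nonneg (p.voidRate_nonneg hr) (Real.exp_pos _).le

lemma integrableOn_pdfRv : IntegrableOn p.pdfRv (Ioi 0) :=
  (integrableOn_and_setLIntegral_Ioi_mul_exp_neg p.continuousOn_voidExponent
    (fun _ hr => p.hasDerivAt_voidExponent hr) (fun _ hr => p.voidRate_nonneg hr)
    p.tendsto_voidExponent le_rfl).1

lemma hasDerivAt_pi_mul_lamb_mul_sq (r : ℝ) :
    HasDerivAt (fun r => Real.pi * p.lamb * r ^ 2) (2 * Real.pi * p.lamb * r) r := by
  convert! (hasDerivAt_pow 2 r).const_mul (Real.pi * p.lamb) using 1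
  ring

lemma tendsto_pi_mul_lamb_mul_sq : Tendsto (fun r => Real.pi * p.lamb * r ^ 2) atTop atTop :=
  (tendsto_pow_atTop two_ne_zero).const_mul_atTop (mul_pos Real.pi_pos p.lamb_pos)

lemma pdfRb_eq (r : ℝ) :
    p.pdfRb r = 2 * Real.pi * p.lamb * r * Real.exp (-(Real.pi * p.lamb * r ^ 2)) := by
  rw [pdfRb, neg_mul, neg_mul]

lemma pdfRb_nonneg {r : ℝ} (hr : 0 < r) : 0 ≤ p.pdfRb r := by
  have := p.lamb_pos
  rw [pdfRb_eq]
  positivity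

lemma integrableOn_pdfRb : IntegrableOn p.pdfRb (Ioi 0) := by
  have := p.lamb_pos
  rw [funext p.pdfRb_eq]
  exact (integrableOn_and_setLIntegral_Ioi_mul_exp_neg (by fun_prop)
    (fun r _ => p.hasDerivAt_pi_mul_lamb_mul_sq r) (fun r hr => by positivity)
    p.tendsto_pi_mul_lamb_mul_sq le_rfl).1

end Params

/-! ### Integrals over lines -/

lemma lintegral_eq_two_mul_of_even {f : ℝ → ℝ≥0∞} (hf : ∀ x, f (-x) = f x) :
    ∫⁻ x, f x = 2 * ∫⁻ x in Ioi 0, f x := by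
  have h := lintegral_image_eq_lintegral_abs_deriv_mul (s := Ioi (0 : ℝ)) (f := fun x => -x)
    (f' := fun _ => -1) measurableSet_Ioi (fun x _ => (hasDerivAt_neg x).hasDerivWithinAt)
    neg_injective.injOn f
  rw [image_neg_eq_neg, neg_Ioi, neg_zero] at h
  simp only [abs_neg, abs_one, ENNReal.ofReal_one, one_mul, hf] at h
  rw [← lintegral_add_compl f measurableSet_Ioi (A := Ioi 0), compl_Ioi,
    setLIntegral_congr Iio_ae_eq_Iic.symm, h, two_mul]

/-- Integration over the representation space of lines of an even function of the signed distance
from the origin. -/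
lemma lintegral_lines {f : ℝ → ℝ≥0∞} (hf : Measurable f) (he : ∀ y, f (-y) = f y) :
    ∫⁻ L : ℝ × ℝ, f L.2 ∂((volume.restrict (Icc (0 : ℝ) Real.pi)).prod volume) =
      ENNReal.ofReal (2 * Real.pi) * ∫⁻ y in Ioi 0, f y := by
  rw [lintegral_prod _ (by fun_prop)]
  simp only [lintegral_const, Measure.restrict_apply MeasurableSet.univ, univ_inter,
    Real.volume_Icc, sub_zero]
  rw [lintegral_eq_two_mul_of_even he, ENNReal.ofReal_mul zero_le_two, ENNReal.ofReal_ofNat]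
  ring

lemma continuous_roadPoint : Continuous fun q : (ℝ × ℝ) × ℝ => roadPoint q.1 q.2 := by
  unfold roadPoint
  refine (PiLp.continuous_toLp 2 _).comp (continuous_pi fun i => ?_)
  fin_cases i
  · simp only [Fin.zero_eta, Matrix.cons_val_zero]
    fun_prop
  · simp only [Fin.mk_one, Matrix.cons_val_one, Matrix.cons_val_zero]
    fun_prop

lemma norm_roadPoint (L : ℝ × ℝ) (t : ℝ) : ‖roadPoint L t‖ = Real.sqrt (L.2 ^ 2 + t ^ 2) := by
  rw [EuclideanSpace.norm_eq, Fin.sum_univ_two]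
  congr 1
  simp only [roadPoint, Real.norm_eq_abs, sq_abs, Matrix.cons_val_zero, Matrix.cons_val_one]
  linear_combination (L.2 ^ 2 + t ^ 2) * Real.sin_sq_add_cos_sq L.1

/-! ### The laws of the distances -/

namespace Network

variable {p : Params} {Ω : Type*} [mΩ : MeasurableSpace Ω] {P : Measure Ω} (N : Network p P)

lemma algebraOf_le (S : Set Source) : N.algebraOf S ≤ mΩ :=
  iSup₂_le fun s _ => N.sourceAlgebra_le s

lemma measurable_line (k : Option ℕ) : Measurable[N.algebraOf vehicleSources] (N.line k) := by
  cases k with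
  | none => exact measurable_const
  | some i => exact N.measurable_algebraOf_roads (by simp [vehicleSources]) i

lemma measurable_position (k : Option ℕ) (j : ℕ) :
    Measurable[N.algebraOf vehicleSources] (N.position k j) := by
  refine continuous_roadPoint.measurable.comp ((N.measurable_line k).prodMk ?_)
  refine N.measurable_algebraOf_nodes (Or.inr (mem_iUnion_of_mem k ?_)) j
  simp [roadSources]

/-- `Measurable.iInf` for a σ-algebra that is not the ambient one. -/
lemma measurable_iInf_of {α ι : Type*} [Countable ι] {m : MeasurableSpace α} {f : ι → α → ℝ}
    (h : ∀ i, Measurable (f i)) : Measurable fun a => ⨅ i, f i a := Measurable.iInf h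

lemma measurable_algebraOf_Rv : Measurable[N.algebraOf vehicleSources] N.Rv :=
  measurable_iInf_of fun q => measurable_norm.comp (N.measurable_position q.1 q.2)

lemma measurable_algebraOf_Rb : Measurable[N.algebraOf {.stations}] N.Rb :=
  measurable_iInf_of fun n => measurable_norm.comp (N.measurable_algebraOf_stations (by simp) n)

lemma measurable_Rv : Measurable N.Rv := N.measurable_algebraOf_Rv.mono (N.algebraOf_le _) le_rfl

lemma measurable_Rb : Measurable N.Rb := N.measurable_algebraOf_Rb.mono (N.algebraOf_le _) le_rfl

lemma indepFun_Rv_Rb : IndepFun N.Rv N.Rb P :=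
  N.indepFun_of_disjoint (by simp [vehicleSources, roadSources]) N.measurable_algebraOf_Rv
    N.measurable_algebraOf_Rb

lemma Rv_nonneg (ω : Ω) : 0 ≤ N.Rv ω := Real.iInf_nonneg fun _ => norm_nonneg _

lemma Rb_nonneg (ω : Ω) : 0 ≤ N.Rb ω := Real.iInf_nonneg fun _ => norm_nonneg _

lemma le_Rv_iff {r : ℝ} {ω : Ω} : r ≤ N.Rv ω ↔ ∀ k j, r ≤ ‖N.position k j ω‖ := by
  rw [Rv, le_ciInf_iff ⟨0, forall_mem_range.2 fun _ => norm_nonneg _⟩, Prod.forall]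

lemma le_Rb_iff {r : ℝ} {ω : Ω} : r ≤ N.Rb ω ↔ ∀ n, r ≤ ‖N.station n ω‖ := by
  rw [Rb, le_ciInf_iff ⟨0, forall_mem_range.2 fun _ => norm_nonneg _⟩]

end Network

/-- The function that is infinite at the nodes within distance `r` of the origin: the Laplace
functional at this function is a void probability. -/
def voidFun (r : ℝ) (L : ℝ × ℝ) (t _g : ℝ) : ℝ≥0∞ := if ‖roadPoint L t‖ < r then ∞ else 0

lemma measurable_voidFun (r : ℝ) :
    Measurable fun q : (ℝ × ℝ) × ℝ × ℝ => voidFun r q.1 q.2.1 q.2.2 := by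
  refine Measurable.ite (measurableSet_lt ?_ measurable_const) measurable_const measurable_const
  exact (continuous_roadPoint.comp (continuous_fst.prodMk
    (continuous_fst.comp continuous_snd))).norm.measurable

namespace Params

variable (p : Params)

/-- A road at distance `|y| < r` meets the disc of radius `r` in a chord of length `2 √(r² - y²)`.
For `|y| ≥ r` the square root is `0`, as is the length of the chord. -/
lemma lineExponent_voidFun {r : ℝ} (hr : 0 < r) (L : ℝ × ℝ) :
    p.lineExponent (voidFun r) L =
      ENNReal.ofReal (2 * p.muv * Real.sqrt (r ^ 2 - L.2 ^ 2)) := by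
  have hpr := isProbabilityMeasure_expMeasure one_pos
  have h : ∀ t, 1 - ∫⁻ g, expNeg (voidFun r L t g) ∂(expMeasure 1) =
      (Ioo (-Real.sqrt (r ^ 2 - L.2 ^ 2)) (Real.sqrt (r ^ 2 - L.2 ^ 2))).indicator 1 t := by
    intro t
    have hiff : ‖roadPoint L t‖ < r ↔
        t ∈ Ioo (-Real.sqrt (r ^ 2 - L.2 ^ 2)) (Real.sqrt (r ^ 2 - L.2 ^ 2)) := by
      rw [norm_roadPoint, Real.sqrt_lt' hr, mem_Ioo, ← abs_lt, Real.lt_sqrt (abs_nonneg t), sq_abs]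
      constructor <;> intro h <;> linarith
    by_cases ht : ‖roadPoint L t‖ < r
    · simp [voidFun, ht, indicator_of_mem (hiff.1 ht)]
    · simp [voidFun, ht, indicator_of_notMem (mt hiff.2 ht)]
  rw [lineExponent]
  simp_rw [h]
  rw [lintegral_indicator_one measurableSet_Ioo, Real.volume_Ioo,
    ← ENNReal.ofReal_mul p.muv_pos.le]
  ring_nf

/-- The integrand vanishes beyond `r`, where the square root of a negative number is `0`. -/
lemma lintegral_one_sub_exp_sqrt {r : ℝ} (hr : 0 < r) :
    ∫⁻ y in Ioi 0, ENNReal.ofReal (1 - Real.exp (-(2 * p.muv * Real.sqrt (r ^ 2 - y ^ 2)))) =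
      ENNReal.ofReal
        (∫ y in (0 : ℝ)..r, (1 - Real.exp (-2 * p.muv * Real.sqrt (r ^ 2 - y ^ 2)))) := by
  have hmu := p.muv_pos
  have h0 : ∫⁻ y in Ioi r,
      ENNReal.ofReal (1 - Real.exp (-(2 * p.muv * Real.sqrt (r ^ 2 - y ^ 2)))) = 0 := by
    rw [setLIntegral_congr_fun (g := fun _ => 0) measurableSet_Ioi, lintegral_zero]
    intro y (hy : r < y)
    simp only
    rw [Real.sqrt_eq_zero_of_nonpos (by nlinarith)]
    simp
  rw [← Ioc_union_Ioi_eq_Ioi hr.le, lintegral_union measurableSet_Ioi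
    Ioc_disjoint_Ioi_same, h0, add_zero,
    intervalIntegral.integral_of_le hr.le, ofReal_integral_eq_lintegral_ofReal]
  · simp only [neg_mul]
  · exact (Continuous.integrableOn_Icc (by fun_prop)).mono_set Ioc_subset_Icc_self
  · refine ae_of_all _ fun y => ?_
    rw [Pi.zero_apply, sub_nonneg, Real.exp_le_one_iff, neg_mul, neg_mul, neg_nonpos]
    positivity

end Params

namespace Network

variable {p : Params} {Ω : Type*} [mΩ : MeasurableSpace Ω] {P : Measure Ω} (N : Network p P)

lemma expNeg_totalSum_voidFun (r : ℝ) (ω : Ω) :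
    expNeg (N.totalSum (voidFun r) ω) = {ω | r ≤ N.Rv ω}.indicator 1 ω := by
  have hterm : ∀ k j, voidFun r (N.line k ω) (N.node k j ω) (N.gain k j ω) =
      if ‖N.position k j ω‖ < r then ∞ else 0 := fun k j => rfl
  by_cases h : r ≤ N.Rv ω
  · rw [indicator_of_mem (show ω ∈ {ω | r ≤ N.Rv ω} from h)]
    rw [le_Rv_iff] at h
    have h0 : ∀ k, N.lineSum (voidFun r) k (N.line k ω) ω = 0 := fun k =>
      ENNReal.tsum_eq_zero.2 fun j => by rw [hterm, if_neg (not_lt.2 (h k j))]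
    simp [totalSum, h0]
  · rw [indicator_of_notMem (show ω ∉ {ω | r ≤ N.Rv ω} from h)]
    rw [le_Rv_iff] at h
    push Not at h
    obtain ⟨k, j, hkj⟩ := h
    have h1 : N.lineSum (voidFun r) k (N.line k ω) ω = ∞ :=
      ENNReal.tsum_eq_top_of_eq_top ⟨j, by rw [hterm, if_pos hkj]⟩
    have h2 : N.totalSum (voidFun r) ω = ∞ := by
      cases k with
      | none => rw [totalSum, h1, top_add]
      | some i => rw [totalSum, ENNReal.tsum_eq_top_of_eq_top ⟨i, h1⟩, add_top]
    rw [h2, expNeg_top]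

variable [IsProbabilityMeasure P]

/-- The probability that no node lies in the open disc of radius `r`. -/
lemma measure_le_Rv {r : ℝ} (hr : 0 < r) :
    P {ω | r ≤ N.Rv ω} = ENNReal.ofReal (Real.exp (-p.voidExponent r)) := by
  have hmu := p.muv_pos
  have hlam := p.lamR_pos
  have hpi := Real.pi_pos
  have h := N.lintegral_expNeg_totalSum (measurable_voidFun r)
  simp_rw [expNeg_totalSum_voidFun, p.lineExponent_voidFun hr] at h
  rw [lintegral_indicator_one (measurableSet_le measurable_const N.measurable_Rv)] at h
  have hone : ∀ y : ℝ, 1 - expNeg (ENNReal.ofReal (2 * p.muv * Real.sqrt (r ^ 2 - y ^ 2))) =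
      ENNReal.ofReal (1 - Real.exp (-(2 * p.muv * Real.sqrt (r ^ 2 - y ^ 2)))) := fun y => by
    rw [expNeg_ofReal (by positivity), ENNReal.ofReal_sub _ (Real.exp_nonneg _),
      ENNReal.ofReal_one]
  simp_rw [hone] at h
  rw [lintegral_lines (f := fun y => ENNReal.ofReal
      (1 - Real.exp (-(2 * p.muv * Real.sqrt (r ^ 2 - y ^ 2))))) (by fun_prop) (by simp),
    p.lintegral_one_sub_exp_sqrt hr, ← expNeg_add, ← ENNReal.ofReal_mul (by positivity),
    ← ENNReal.ofReal_mul hlam.le] at h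
  have hI := p.integral_one_sub_exp_sqrt_nonneg hr.le
  rw [← ENNReal.ofReal_add (by positivity) (by positivity), expNeg_ofReal (by positivity)] at h
  rw [h, Params.voidExponent]
  simp only [ne_eq, OfNat.ofNat_ne_zero, not_false_eq_true, zero_pow, sub_zero, Real.sqrt_sq hr.le]
  ring_nf

theorem hasLaw_Rv : HasLaw N.Rv ((volume.restrict (Ioi (0 : ℝ))).withDensity
    fun r => ENNReal.ofReal (p.pdfRv r)) P :=
  hasLaw_of_tail N.measurable_Rv N.Rv_nonneg (by simp [Params.voidExponent])
    p.continuousOn_voidExponent (fun _ hr => p.hasDerivAt_voidExponent hr)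
    (fun _ hr => p.voidRate_nonneg hr) p.tendsto_voidExponent fun _ hr => N.measure_le_Rv hr

/-- The probability that no station lies in the open disc of radius `r`. -/
lemma measure_le_Rb {r : ℝ} (hr : 0 < r) :
    P {ω | r ≤ N.Rb ω} = ENNReal.ofReal (Real.exp (-(Real.pi * p.lamb * r ^ 2))) := by
  have hlam := p.lamb_pos
  have hpi := Real.pi_pos
  have hball := measurableSet_ball (x := (0 : EuclideanSpace ℝ (Fin 2))) (ε := r)
  -- a void probability is the Laplace functional at `∞` times an indicator
  have h := N.station_poisson.lintegral_expNeg_tsum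
    (g := (Metric.ball 0 r).indicator fun _ => ∞) (measurable_const.indicator hball)
  have h1 : ∀ ω, expNeg (∑' n, (Metric.ball (0 : EuclideanSpace ℝ (Fin 2)) r).indicator
      (fun _ => ∞) (N.station n ω)) = {ω | r ≤ N.Rb ω}.indicator 1 ω := by
    intro ω
    by_cases hω : r ≤ N.Rb ω
    · rw [indicator_of_mem (show ω ∈ {ω | r ≤ N.Rb ω} from hω)]
      rw [le_Rb_iff] at hω
      rw [ENNReal.tsum_eq_zero.2 fun n => indicator_of_notMem (by simpa using hω n) _,
        expNeg_zero, Pi.one_apply]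
    · rw [indicator_of_notMem (show ω ∉ {ω | r ≤ N.Rb ω} from hω)]
      rw [le_Rb_iff] at hω
      push Not at hω
      obtain ⟨n, hn⟩ := hω
      rw [ENNReal.tsum_eq_top_of_eq_top ⟨n, indicator_of_mem (by simpa using hn) _⟩, expNeg_top]
  have h2 : ∀ x : EuclideanSpace ℝ (Fin 2), 1 - expNeg ((Metric.ball 0 r).indicator
      (fun _ => ∞) x) = (Metric.ball 0 r).indicator 1 x := by
    intro x
    by_cases hx : x ∈ Metric.ball (0 : EuclideanSpace ℝ (Fin 2)) r
    · simp [indicator_of_mem hx]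
    · simp [indicator_of_notMem hx]
  simp_rw [h1, h2] at h
  rw [lintegral_indicator_one (measurableSet_le measurable_const N.measurable_Rb),
    lintegral_indicator_one hball, Measure.smul_apply, EuclideanSpace.volume_ball_fin_two,
    smul_eq_mul] at h
  rw [h, ← expNeg_ofReal (by positivity), ENNReal.ofReal_mul (by positivity),
    ENNReal.ofReal_mul hpi.le, ENNReal.ofReal_pow hr.le]
  congr 1
  rw [show (ENNReal.ofReal Real.pi) = (NNReal.pi : ℝ≥0∞) from
    ENNReal.ofReal_coe_nnreal (p := NNReal.pi)]
  ring

theorem hasLaw_Rb : HasLaw N.Rb ((volume.restrict (Ioi (0 : ℝ))).withDensity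
    fun r => ENNReal.ofReal (p.pdfRb r)) P := by
  have hlam := p.lamb_pos
  have hpi := Real.pi_pos
  rw [funext p.pdfRb_eq]
  exact hasLaw_of_tail N.measurable_Rb N.Rb_nonneg (by simp) (by fun_prop)
    (fun r _ => p.hasDerivAt_pi_mul_lamb_mul_sq r) (fun r hr => by positivity)
    p.tendsto_pi_mul_lamb_mul_sq fun _ hr => N.measure_le_Rb hr

lemma ae_Rv_pos : ∀ᵐ ω ∂P, 0 < N.Rv ω := by
  rw [N.hasLaw_Rv.ae_iff (p := fun r => 0 < r) (measurableSet_Ioi (a := (0 : ℝ))).mem]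
  exact withDensity_absolutelyContinuous _ _ |>.ae_le (ae_restrict_mem measurableSet_Ioi)

lemma ae_Rb_pos : ∀ᵐ ω ∂P, 0 < N.Rb ω := by
  rw [N.hasLaw_Rb.ae_iff (p := fun r => 0 < r) (measurableSet_Ioi (a := (0 : ℝ))).mem]
  exact withDensity_absolutelyContinuous _ _ |>.ae_le (ae_restrict_mem measurableSet_Ioi)

end Network

/-! ### The association probabilities -/

namespace Network

variable {p : Params} {Ω : Type*} [mΩ : MeasurableSpace Ω] {P : Measure Ω} (N : Network p P)
  [IsProbabilityMeasure P]

theorem condAssocV2V_eq {r : ℝ} (hr : 0 < r) :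
    N.condAssocV2V r = ENNReal.ofReal (p.assocV2V r) := by
  have hB := p.B_pos
  have hα := p.one_lt_alphab
  have hα0 : p.alphab ≠ 0 := by linarith
  set ρ := r ^ (p.alphav / p.alphab) / p.B ^ (1 / p.alphab) with hρ
  have hρ0 : 0 < ρ := by positivity
  -- `ρ` is the distance at which both sides of the selection rule agree
  have hρα : ρ ^ (-p.alphab) = p.B * r ^ (-p.alphav) := by
    rw [hρ, Real.div_rpow (by positivity) (by positivity), ← Real.rpow_mul hr.le,
      ← Real.rpow_mul hB.le]
    rw [show p.alphav / p.alphab * -p.alphab = -p.alphav by field_simp,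
      show 1 / p.alphab * -p.alphab = -1 by field_simp, Real.rpow_neg_one]
    field_simp
  have h : P {ω | N.Rb ω ^ (-p.alphab) ≤ p.B * r ^ (-p.alphav)} = P {ω | ρ ≤ N.Rb ω} := by
    refine measure_congr ?_
    filter_upwards [N.ae_Rb_pos] with ω hω
    refine propext ?_
    change N.Rb ω ^ (-p.alphab) ≤ p.B * r ^ (-p.alphav) ↔ ρ ≤ N.Rb ω
    rw [← hρα, Real.rpow_le_rpow_iff_of_neg hω hρ0 (by linarith)]
  rw [condAssocV2V, h, N.measure_le_Rb hρ0, Params.assocV2V, ← hρ, neg_mul,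
    neg_mul]

lemma measure_Rv_eq (r : ℝ) : P {ω | N.Rv ω = r} = 0 := by
  rw [N.hasLaw_Rv.measure_eq (p := fun x => x = r) (measurableSet_singleton r)]
  exact ((withDensity_absolutelyContinuous _ _).trans Measure.absolutelyContinuous_restrict)
    (measure_singleton r)

theorem condAssocV2B_eq {r : ℝ} (hr : 0 < r) :
    N.condAssocV2B r = ENNReal.ofReal (p.assocV2B r) := by
  have hB := p.B_pos
  have hα := p.one_lt_alphav
  have hα0 : p.alphav ≠ 0 := by linarith
  set κ := p.B ^ (1 / p.alphav) * r ^ (p.alphab / p.alphav) with hκ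
  have hκ0 : 0 < κ := by positivity
  -- `κ` is the distance at which both sides of the selection rule agree
  have hκα : p.B * κ ^ (-p.alphav) = r ^ (-p.alphab) := by
    rw [hκ, Real.mul_rpow (by positivity) (by positivity), ← Real.rpow_mul hr.le,
      ← Real.rpow_mul hB.le]
    rw [show p.alphab / p.alphav * -p.alphav = -p.alphab by field_simp,
      show 1 / p.alphav * -p.alphav = -1 by field_simp, Real.rpow_neg_one]
    field_simp
  have h : P {ω | p.B * N.Rv ω ^ (-p.alphav) < r ^ (-p.alphab)} = P {ω | κ ≤ N.Rv ω} := by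
    refine measure_congr ?_
    -- the selection rule is strict here, and the tail of `R_v` is that of `κ ≤ R_v`
    have hne : ∀ᵐ ω ∂P, N.Rv ω ≠ κ := by
      rw [ae_iff]
      simpa using N.measure_Rv_eq κ
    filter_upwards [N.ae_Rv_pos, hne] with ω hω hωκ
    refine propext ?_
    change p.B * N.Rv ω ^ (-p.alphav) < r ^ (-p.alphab) ↔ κ ≤ N.Rv ω
    rw [← hκα, mul_lt_mul_iff_right₀ hB, Real.rpow_lt_rpow_iff_of_neg hω hκ0 (by linarith),
      lt_iff_le_and_ne]
    exact and_iff_left hωκ.symm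
  rw [condAssocV2B, h, N.measure_le_Rv hκ0, Params.assocV2B]

end Network

/-! ### Exponential gains -/

lemma expMeasure_lt_ofReal (t : ℝ≥0∞) : expMeasure 1 {g | t < ENNReal.ofReal g} = expNeg t := by
  have := isProbabilityMeasure_expMeasure one_pos
  induction t with
  | top => simp
  | coe a =>
    have h1 : {g | (a : ℝ≥0∞) < ENNReal.ofReal g} = (Iic (a : ℝ))ᶜ := by
      ext g
      rw [compl_Iic, mem_ofPred_eq, mem_Ioi, ENNReal.lt_ofReal_iff_toReal_lt ENNReal.coe_ne_top,
        ENNReal.coe_toReal]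
    have h2 := cdf_expMeasure_eq one_pos (a : ℝ)
    rw [if_pos a.coe_nonneg] at h2
    rw [h1, prob_compl_eq_one_sub measurableSet_Iic, ← ofReal_cdf, h2, expNeg_coe,
      ← ENNReal.ofReal_one, ← ENNReal.ofReal_sub]
    · simp
    · simp

/-- The Laplace transform of the exponential distribution: tilting the density gives a multiple of
the density with rate `1 + a`. -/
lemma lintegral_expNeg_mul_expMeasure {a : ℝ} (ha : 0 ≤ a) :
    ∫⁻ g, expNeg (ENNReal.ofReal (a * g)) ∂(expMeasure 1) = ENNReal.ofReal (1 / (1 + a)) := by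
  have h : ∀ g, exponentialPDF 1 g * expNeg (ENNReal.ofReal (a * g)) =
      ENNReal.ofReal (1 / (1 + a)) * exponentialPDF (1 + a) g := by
    intro g
    rcases lt_or_ge g 0 with hg | hg
    · rw [exponentialPDF_of_neg hg, exponentialPDF_of_neg hg, zero_mul, mul_zero]
    · rw [exponentialPDF_of_nonneg hg, exponentialPDF_of_nonneg hg, expNeg_ofReal (by positivity),
        ← ENNReal.ofReal_mul (by positivity), ← ENNReal.ofReal_mul (by positivity)]
      congr 1
      rw [show -((1 + a) * g) = -(1 * g) + -(a * g) by ring, Real.exp_add]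
      field_simp
  have hm : ∀ b, Measurable (exponentialPDF b) := fun b =>
    (measurable_exponentialPDFReal b).ennreal_ofReal
  have he : expMeasure 1 = volume.withDensity (exponentialPDF 1) := rfl
  rw [he, lintegral_withDensity_eq_lintegral_mul _ (hm 1) (by fun_prop)]
  simp only [Pi.mul_apply, h]
  rw [lintegral_const_mul _ (hm _), lintegral_exponentialPDF_eq_one (by positivity), mul_one]

/-- An exponential variable exceeds an independent threshold `T` with probability
`E exp (-T)`. -/
lemma measure_lt_ofReal_of_indepFun {Ω : Type*} [MeasurableSpace Ω] {P : Measure Ω}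
    [IsProbabilityMeasure P] {T : Ω → ℝ≥0∞} {h : Ω → ℝ} (hT : Measurable T) (hh : Measurable h)
    (hlaw : HasLaw h (expMeasure 1) P) (hind : IndepFun T h P) :
    P {ω | T ω < ENNReal.ofReal (h ω)} = ∫⁻ ω, expNeg (T ω) ∂P := by
  have hS : MeasurableSet {q : ℝ≥0∞ × ℝ | q.1 < ENNReal.ofReal q.2} :=
    measurableSet_lt measurable_fst measurable_snd.ennreal_ofReal
  have h1 := (indepFun_iff_map_prod_eq_prod_map_map hT.aemeasurable hh.aemeasurable).1 hind
  have := isProbabilityMeasure_expMeasure one_pos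
  have h2 : P {ω | T ω < ENNReal.ofReal (h ω)} =
      P.map (fun ω => (T ω, h ω)) {q : ℝ≥0∞ × ℝ | q.1 < ENNReal.ofReal q.2} := by
    rw [Measure.map_apply (hT.prodMk hh) hS]
    rfl
  rw [h2, h1, hlaw.map_eq, Measure.prod_apply hS]
  simp only [preimage_ofPred_eq, expMeasure_lt_ofReal]
  rw [lintegral_map measurable_expNeg hT]

/-! ### Evaluation of the Laplace transforms -/

namespace Params

variable (p : Params)

/-- One minus the Laplace transform at `s` of the interference of a single node with exponential
gain, at coordinate `t` on a road at distance `y` from the origin. -/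
def loss (α s y t : ℝ) : ℝ := 1 - 1 / (1 + s * p.Pv * (y ^ 2 + t ^ 2) ^ (-α / 2))

variable {p} {α s r : ℝ}

lemma measurable_loss : Measurable fun q : ℝ × ℝ => p.loss α s q.1 q.2 := by
  unfold loss
  fun_prop

lemma loss_nonneg (hs : 0 ≤ s) (y t : ℝ) : 0 ≤ p.loss α s y t := by
  have := p.Pv_pos
  have h : 0 ≤ s * p.Pv * (y ^ 2 + t ^ 2) ^ (-α / 2) := by positivity
  rw [loss, sub_nonneg, div_le_one (by positivity)]
  linarith

lemma loss_le_one (hs : 0 ≤ s) (y t : ℝ) : p.loss α s y t ≤ 1 := by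
  have := p.Pv_pos
  rw [loss, sub_le_self_iff]
  positivity

lemma loss_le (hα : 0 ≤ α) (hs : 0 ≤ s) {x y t : ℝ} (hx : 0 < x) (h : x ^ 2 ≤ y ^ 2 + t ^ 2) :
    p.loss α s y t ≤ s * p.Pv * x ^ (-α) := by
  have hP := p.Pv_pos
  have h1 : (y ^ 2 + t ^ 2) ^ (-α / 2) ≤ x ^ (-α) := by
    calc (y ^ 2 + t ^ 2) ^ (-α / 2) ≤ (x ^ 2) ^ (-α / 2) :=
          Real.rpow_le_rpow_of_nonpos (by positivity) h (by linarith)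
      _ = x ^ (-α) := by
          rw [← Real.rpow_natCast, ← Real.rpow_mul hx.le]
          congr 1
          push_cast
          ring
  have h2 : 0 ≤ s * p.Pv * (y ^ 2 + t ^ 2) ^ (-α / 2) := by positivity
  have h3 : p.loss α s y t ≤ s * p.Pv * (y ^ 2 + t ^ 2) ^ (-α / 2) := by
    rw [loss, sub_le_iff_le_add, ← sub_le_iff_le_add', le_div_iff₀ (by positivity)]
    nlinarith
  exact h3.trans (mul_le_mul_of_nonneg_left h1 (by positivity))

lemma integrableOn_loss (hα : 1 < α) (hs : 0 ≤ s) (y : ℝ) {a : ℝ} (ha : 0 ≤ a) :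
    IntegrableOn (p.loss α s y) (Ioi a) := by
  have hm : Measurable (p.loss α s y) := by
    unfold loss
    fun_prop
  rw [← Ioc_union_Ioi_eq_Ioi (by linarith : a ≤ a + 1)]
  refine IntegrableOn.union ?_ ?_
  · refine Measure.integrableOn_of_bounded (M := 1) (by simp) hm.aestronglyMeasurable
      (ae_of_all _ fun t => ?_)
    rw [Real.norm_eq_abs, abs_of_nonneg (loss_nonneg hs y t)]
    exact loss_le_one hs y t
  · refine Integrable.mono' ((integrableOn_Ioi_rpow_of_lt (a := -α) (c := a + 1) (by linarith)
      (by linarith)).const_mul (s * p.Pv)) hm.aestronglyMeasurable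
      ((ae_restrict_iff' measurableSet_Ioi).2 (ae_of_all _ fun t (ht : a + 1 < t) => ?_))
    rw [Real.norm_eq_abs, abs_of_nonneg (loss_nonneg hs y t)]
    exact loss_le (by linarith) hs (by linarith) (by nlinarith [sq_nonneg y])

/-- A road at distance `y` contributes an exponent of order `y ^ (1 - α)`: the nodes at `|t| ≤ y`
are about as far from the origin as the foot of the road, and those beyond are about as far as
their coordinate. -/
lemma integral_loss_le (hα : 1 < α) (hs : 0 ≤ s) {y : ℝ} (hy : 0 < y) :
    ∫ t in Ioi 0, p.loss α s y t ≤ s * p.Pv * (1 + 1 / (α - 1)) * y ^ (1 - α) := by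
  have hint := integrableOn_loss (p := p) hα hs y le_rfl
  have h1 : ∫ t in Ioc 0 y, p.loss α s y t ≤ s * p.Pv * y ^ (1 - α) := by
    calc ∫ t in Ioc 0 y, p.loss α s y t ≤ ∫ t in Ioc 0 y, s * p.Pv * y ^ (-α) :=
          setIntegral_mono (hint.mono_set Ioc_subset_Ioi_self)
            (integrableOn_const (by simp) enorm_ne_top)
            fun t => loss_le (by linarith) hs hy (by nlinarith [sq_nonneg t])
      _ = s * p.Pv * y ^ (1 - α) := by
          rw [setIntegral_const, Measure.real, Real.volume_Ioc, sub_zero,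
            ENNReal.toReal_ofReal hy.le, smul_eq_mul, sub_eq_add_neg, Real.rpow_add hy,
            Real.rpow_one]
          ring
  have h2 : ∫ t in Ioi y, p.loss α s y t ≤ s * p.Pv * (y ^ (1 - α) / (α - 1)) := by
    calc ∫ t in Ioi y, p.loss α s y t ≤ ∫ t in Ioi y, s * p.Pv * t ^ (-α) :=
          setIntegral_mono_on (hint.mono_set (Ioi_subset_Ioi hy.le))
            ((integrableOn_Ioi_rpow_of_lt (by linarith) hy).const_mul _) measurableSet_Ioi
            fun t (ht : y < t) => loss_le (by linarith) hs (hy.trans ht)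
              (by nlinarith [sq_nonneg y])
      _ = s * p.Pv * (y ^ (1 - α) / (α - 1)) := by
          rw [integral_const_mul, integral_Ioi_rpow_of_lt (by linarith) hy,
            show -α + 1 = -(α - 1) by ring, neg_div_neg_eq, neg_sub]
  rw [← Ioc_union_Ioi_eq_Ioi hy.le, setIntegral_union
    Ioc_disjoint_Ioi_same measurableSet_Ioi
    (hint.mono_set Ioc_subset_Ioi_self) (hint.mono_set (Ioi_subset_Ioi hy.le))]
  calc _ ≤ s * p.Pv * y ^ (1 - α) + s * p.Pv * (y ^ (1 - α) / (α - 1)) := add_le_add h1 h2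
    _ = _ := by ring

lemma lapIn_eq (y : ℝ) :
    p.lapIn α s r y = Real.exp (-(2 * p.muv * ∫ t in Ioi (Real.sqrt (r ^ 2 - y ^ 2)),
      p.loss α s y t)) := by
  rw [lapIn, neg_mul, neg_mul]
  rfl

lemma lapIn_le_one (hs : 0 ≤ s) (y : ℝ) : p.lapIn α s r y ≤ 1 := by
  have := p.muv_pos
  have h : 0 ≤ ∫ t in Ioi (Real.sqrt (r ^ 2 - y ^ 2)), p.loss α s y t :=
    integral_nonneg fun t => loss_nonneg hs y t
  rw [lapIn_eq, Real.exp_le_one_iff, neg_nonpos]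
  positivity

lemma lapIn_neg (y : ℝ) : p.lapIn α s r (-y) = p.lapIn α s r y := by
  simp only [lapIn, even_two.neg_pow]

/-- For `y ≥ r` the lower limit `√(r² - y²)` of the integral in `lapIn` is `0`, so `lapIn` serves
for all roads. -/
lemma lapIn_eq_lapOut (hr : 0 ≤ r) {y : ℝ} (hy : r ≤ y) : p.lapIn α s r y = p.lapOut α s y := by
  rw [lapIn, lapOut, Real.sqrt_eq_zero_of_nonpos (by nlinarith)]

lemma measurable_lapIn : Measurable (p.lapIn α s r) := by
  have h : Measurable fun y => ∫ t in Ioi (Real.sqrt (r ^ 2 - y ^ 2)), p.loss α s y t := by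
    simp_rw [← integral_indicator measurableSet_Ioi]
    refine StronglyMeasurable.measurable (StronglyMeasurable.integral_prod_right'
      (f := fun q : ℝ × ℝ =>
        (Ioi (Real.sqrt (r ^ 2 - q.1 ^ 2))).indicator (p.loss α s q.1) q.2) ?_)
    have hset : MeasurableSet {q : ℝ × ℝ | Real.sqrt (r ^ 2 - q.1 ^ 2) < q.2} :=
      measurableSet_lt (by fun_prop) measurable_snd
    convert! (measurable_loss (p := p) (α := α) (s := s)).stronglyMeasurable.indicator hset using 2
  simp only [funext (lapIn_eq (p := p) (α := α) (s := s) (r := r))]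
  fun_prop

/-- The total exponent of all roads is finite: if `R` is finite the domain is bounded, and otherwise
`1 - lapIn` is bounded by a multiple of `y ^ (1 - α)` with `α > 2` beyond `r`. -/
lemma integrableOn_one_sub_lapIn (hα : 1 < α) (hR : p.R = ∞ → 2 < α) (hs : 0 ≤ s) (hr : 0 < r) :
    IntegrableOn (fun y => 1 - p.lapIn α s r y) (Ioi 0 ∩ {y | ENNReal.ofReal y ≤ p.R}) := by
  have hmu := p.muv_pos
  have hPv := p.Pv_pos
  have hm : Measurable fun y => 1 - p.lapIn α s r y := measurable_const.sub measurable_lapIn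
  have hb : ∀ y, ‖1 - p.lapIn α s r y‖ ≤ 1 := fun y => by
    rw [Real.norm_eq_abs, abs_of_nonneg (sub_nonneg.2 (lapIn_le_one hs y)), sub_le_self_iff]
    exact (Real.exp_pos _).le
  have hfin : ∀ a, IntegrableOn (fun y => 1 - p.lapIn α s r y) (Ioc 0 a) := fun a =>
    Measure.integrableOn_of_bounded (M := 1) (by simp) hm.aestronglyMeasurable (ae_of_all _ hb)
  rcases eq_or_ne p.R ∞ with h | h
  · refine IntegrableOn.mono_set (t := Ioc 0 r ∪ Ioi r) ((hfin r).union ?_) ?_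
    · refine Integrable.mono' ((integrableOn_Ioi_rpow_of_lt (a := 1 - α) (c := r)
        (by linarith [hR h]) hr).const_mul (2 * p.muv * (s * p.Pv * (1 + 1 / (α - 1)))))
        hm.aestronglyMeasurable
        ((ae_restrict_iff' measurableSet_Ioi).2 (ae_of_all _ fun y (hy : r < y) => ?_))
      rw [Real.norm_eq_abs, abs_of_nonneg (sub_nonneg.2 (lapIn_le_one hs y)), lapIn_eq,
        Real.sqrt_eq_zero_of_nonpos (by nlinarith)]
      have h1 := Real.one_sub_le_exp_neg (2 * p.muv * ∫ t in Ioi 0, p.loss α s y t)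
      have h2 := mul_le_mul_of_nonneg_left (integral_loss_le (p := p) hα hs (hr.trans hy))
        (by positivity : 0 ≤ 2 * p.muv)
      linarith
    · rw [Ioc_union_Ioi_eq_Ioi hr.le]
      exact inter_subset_left
  · refine (hfin p.R.toReal).mono_set fun y hy => ⟨hy.1, ?_⟩
    exact (ENNReal.ofReal_le_iff_le_toReal h).1 hy.2

/-- The substitution `t = r * u ^ (-1 / α)` turns the exponent of the road through the origin into
Euler's integral. -/
lemma integral_loss_zero (hα : 1 < α) {z : ℝ} (hz : 0 < z) (hr : 0 < r)
    (hs : s * p.Pv = z * r ^ α) :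
    ∫ t in Ioi r, p.loss α s 0 t =
      r * z * hyp2F1 1 ((α - 1) / α) (2 - 1 / α) (-z) / (α - 1) := by
  have hα0 : 0 < α := by linarith
  have hαn : α ≠ 0 := hα0.ne'
  have hα1 : 0 < α - 1 := by linarith
  have hb : 0 < (α - 1) / α := by positivity
  have hinj : InjOn (fun u : ℝ => r * u ^ (-(1 / α))) (Ioo 0 1) := by
    intro a ha b hb hab
    have h := mul_left_cancel₀ hr.ne' hab
    exact (Real.rpow_left_inj ha.1.le hb.1.le (by simp [hαn])).1 h
  have himg : (fun u : ℝ => r * u ^ (-(1 / α))) '' Ioo 0 1 = Ioi r := by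
    ext t
    constructor
    · rintro ⟨u, hu, rfl⟩
      have := Real.one_lt_rpow_of_pos_of_lt_one_of_neg hu.1 hu.2
        (by simp [hα0] : -(1 / α) < 0)
      exact (lt_mul_iff_one_lt_right hr).2 this
    · intro (ht : r < t)
      have ht0 := hr.trans ht
      refine ⟨(t / r) ^ (-α), ⟨by positivity, Real.rpow_lt_one_of_one_lt_of_neg
        ((one_lt_div hr).2 ht) (by linarith)⟩, ?_⟩
      simp only
      rw [← Real.rpow_mul (by positivity), show -α * -(1 / α) = 1 by field_simp, Real.rpow_one]
      field_simp
  have hderiv : ∀ u ∈ Ioo (0 : ℝ) 1, HasDerivWithinAt (fun u : ℝ => r * u ^ (-(1 / α)))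
      (r * (-(1 / α) * u ^ (-(1 / α) - 1))) (Ioo 0 1) u := fun u hu =>
    ((Real.hasDerivAt_rpow_const (Or.inl hu.1.ne')).const_mul r).hasDerivWithinAt
  rw [← himg, integral_image_eq_integral_abs_deriv_smul measurableSet_Ioo hderiv hinj, hyp2F1,
    intervalIntegral.integral_of_le zero_le_one, integral_Ioc_eq_integral_Ioo]
  have hGamma : Real.Gamma (2 - 1 / α) /
      (Real.Gamma ((α - 1) / α) * Real.Gamma (2 - 1 / α - (α - 1) / α)) = (α - 1) / α := by
    have hG := (Real.Gamma_pos_of_pos hb).ne'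
    rw [show 2 - 1 / α - (α - 1) / α = 1 by field_simp; ring,
      show 2 - 1 / α = (α - 1) / α + 1 by field_simp; ring, Real.Gamma_add_one hb.ne',
      Real.Gamma_one]
    field_simp
  rw [hGamma, show r * z * ((α - 1) / α * ∫ t in Ioo (0 : ℝ) 1, t ^ ((α - 1) / α - 1) *
      (1 - t) ^ (2 - 1 / α - (α - 1) / α - 1) * (1 - -z * t) ^ (-1 : ℝ)) / (α - 1) =
      r * z / α * ∫ t in Ioo (0 : ℝ) 1, t ^ ((α - 1) / α - 1) *
      (1 - t) ^ (2 - 1 / α - (α - 1) / α - 1) * (1 - -z * t) ^ (-1 : ℝ) by field_simp,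
    ← integral_const_mul]
  refine setIntegral_congr_fun measurableSet_Ioo fun u hu => ?_
  have hu0 : 0 < u := hu.1
  have hpow : s * p.Pv * ((0 : ℝ) ^ 2 + (r * u ^ (-(1 / α))) ^ 2) ^ (-α / 2) = z * u := by
    rw [hs, zero_pow two_ne_zero, zero_add, ← Real.rpow_natCast, ← Real.rpow_mul (by positivity),
      Real.mul_rpow hr.le (by positivity), ← Real.rpow_mul hu0.le,
      show ((2 : ℕ) : ℝ) * (-α / 2) = -α by push_cast; ring,
      show -(1 / α) * -α = 1 by field_simp, Real.rpow_one, Real.rpow_neg hr.le]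
    field_simp
  simp only [smul_eq_mul, loss]
  rw [hpow, show 2 - 1 / α - (α - 1) / α - 1 = 0 by field_simp; ring, Real.rpow_zero,
    Real.rpow_neg_one, show (α - 1) / α - 1 = -(1 / α) by field_simp; ring,
    show r * (-(1 / α) * u ^ (-(1 / α) - 1)) = -(r * (1 / α * u ^ (-(1 / α) - 1))) by ring,
    abs_neg, abs_of_pos (by positivity), Real.rpow_sub_one hu0.ne']
  have : 0 < 1 + z * u := by positivity
  have h' : 1 - -z * u = 1 + z * u := by ring
  rw [h']
  field_simp
  ring

end Params

/-! ### The conditional success probability -/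

/-- The interference of a node with gain `g` at coordinate `t` on the road `L`, weighted by `s`. It
is `0` in the disc of radius `r` and on roads that do not meet the disc of radius `R`. -/
def interferenceFun (p : Params) (α r s : ℝ) (L : ℝ × ℝ) (t g : ℝ) : ℝ≥0∞ :=
  if ENNReal.ofReal |L.2| ≤ p.R ∧ r < ‖roadPoint L t‖ then
    ENNReal.ofReal (s * (p.Pv * g * ‖roadPoint L t‖ ^ (-α))) else 0

lemma measurable_interferenceFun (p : Params) (α r s : ℝ) :
    Measurable fun q : (ℝ × ℝ) × ℝ × ℝ => interferenceFun p α r s q.1 q.2.1 q.2.2 := by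
  have h : Measurable fun q : (ℝ × ℝ) × ℝ × ℝ => ‖roadPoint q.1 q.2.1‖ :=
    (continuous_roadPoint.comp (continuous_fst.prodMk
      (continuous_fst.comp continuous_snd))).norm.measurable
  unfold interferenceFun
  have h1 : MeasurableSet {q : (ℝ × ℝ) × ℝ × ℝ | ENNReal.ofReal |q.1.2| ≤ p.R} :=
    measurableSet_le (by fun_prop) measurable_const
  exact Measurable.ite (h1.inter (measurableSet_lt measurable_const h)) (by fun_prop)
    measurable_const

namespace Params

variable {p : Params} {α s r : ℝ}

lemma one_sub_lintegral_expNeg_interferenceFun (hs : 0 ≤ s) {L : ℝ × ℝ} (t : ℝ) :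
    1 - ∫⁻ g, expNeg (interferenceFun p α r s L t g) ∂(expMeasure 1) =
      if ENNReal.ofReal |L.2| ≤ p.R ∧ r < ‖roadPoint L t‖ then
        ENNReal.ofReal (p.loss α s L.2 t) else 0 := by
  have hpr := isProbabilityMeasure_expMeasure one_pos
  have hPv := p.Pv_pos
  by_cases h : ENNReal.ofReal |L.2| ≤ p.R ∧ r < ‖roadPoint L t‖
  · have hpow : ‖roadPoint L t‖ ^ (-α) = (L.2 ^ 2 + t ^ 2) ^ (-α / 2) := by
      rw [norm_roadPoint, Real.sqrt_eq_rpow, ← Real.rpow_mul (by positivity)]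
      ring_nf
    have h1 : ∀ g, interferenceFun p α r s L t g =
        ENNReal.ofReal (s * p.Pv * (L.2 ^ 2 + t ^ 2) ^ (-α / 2) * g) := fun g => by
      rw [interferenceFun, if_pos h, hpow]
      ring_nf
    simp_rw [h1]
    rw [if_pos h, lintegral_expNeg_mul_expMeasure (by positivity), ← ENNReal.ofReal_one,
      ← ENNReal.ofReal_sub _ (by positivity), loss]
  · simp [interferenceFun, if_neg h]

lemma lineExponent_interferenceFun (hα : 1 < α) (hs : 0 ≤ s) (hr : 0 < r) {L : ℝ × ℝ}
    (hL : ENNReal.ofReal |L.2| ≤ p.R) :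
    p.lineExponent (interferenceFun p α r s) L =
      ENNReal.ofReal (2 * p.muv * ∫ t in Ioi (Real.sqrt (r ^ 2 - L.2 ^ 2)), p.loss α s L.2 t) := by
  have hmu := p.muv_pos
  rw [lineExponent]
  simp_rw [one_sub_lintegral_expNeg_interferenceFun hs, hL, true_and, norm_roadPoint]
  have heven : ∀ t : ℝ, (if r < Real.sqrt (L.2 ^ 2 + (-t) ^ 2) then
      ENNReal.ofReal (p.loss α s L.2 (-t)) else 0) = if r < Real.sqrt (L.2 ^ 2 + t ^ 2) then
      ENNReal.ofReal (p.loss α s L.2 t) else 0 := fun t => by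
    simp only [loss, even_two.neg_pow]
  rw [lintegral_eq_two_mul_of_even heven]
  have h1 : ∫⁻ t in Ioi 0, (if r < Real.sqrt (L.2 ^ 2 + t ^ 2) then
      ENNReal.ofReal (p.loss α s L.2 t) else 0) =
      ∫⁻ t in Ioi 0, (Ioi (Real.sqrt (r ^ 2 - L.2 ^ 2))).indicator
        (fun t => ENNReal.ofReal (p.loss α s L.2 t)) t := by
    refine setLIntegral_congr_fun measurableSet_Ioi fun t (ht : 0 < t) => ?_
    have hiff : r < Real.sqrt (L.2 ^ 2 + t ^ 2) ↔ t ∈ Ioi (Real.sqrt (r ^ 2 - L.2 ^ 2)) := by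
      rw [Real.lt_sqrt hr.le, mem_Ioi, Real.sqrt_lt' ht]
      constructor <;> intro h <;> linarith
    simp only [indicator, hiff]
  rw [h1, lintegral_indicator measurableSet_Ioi, Measure.restrict_restrict measurableSet_Ioi,
    inter_eq_left.2 (Ioi_subset_Ioi (Real.sqrt_nonneg _)),
    ← ofReal_integral_eq_lintegral_ofReal (integrableOn_loss hα hs L.2 (Real.sqrt_nonneg _))
      (ae_of_all _ fun t => loss_nonneg hs L.2 t), ENNReal.ofReal_mul (by positivity),
    ENNReal.ofReal_mul zero_le_two, ENNReal.ofReal_ofNat]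
  ring

lemma expNeg_lineExponent_interferenceFun (hα : 1 < α) (hs : 0 ≤ s) (hr : 0 < r) (L : ℝ × ℝ) :
    expNeg (p.lineExponent (interferenceFun p α r s) L) =
      if ENNReal.ofReal |L.2| ≤ p.R then ENNReal.ofReal (p.lapIn α s r L.2) else 1 := by
  have hmu := p.muv_pos
  split_ifs with hL
  · have : 0 ≤ ∫ t in Ioi (Real.sqrt (r ^ 2 - L.2 ^ 2)), p.loss α s L.2 t :=
      integral_nonneg fun t => loss_nonneg hs _ t
    rw [lineExponent_interferenceFun hα hs hr hL, expNeg_ofReal (by positivity), lapIn_eq]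
  · rw [lineExponent]
    simp_rw [one_sub_lintegral_expNeg_interferenceFun hs, hL, false_and, if_false]
    simp

lemma lapIn_zero_eq_lapIr (hα : 1 < α) {z : ℝ} (hz : 0 < z) (hr : 0 < r)
    (hs : s * p.Pv = z * r ^ α) : p.lapIn α s r 0 = p.lapIr α z r := by
  rw [lapIn_eq, lapIr, zero_pow two_ne_zero, sub_zero, Real.sqrt_sq hr.le,
    integral_loss_zero hα hz hr hs]
  ring_nf

lemma lapIr_nonneg {z : ℝ} : 0 ≤ p.lapIr α z r := (Real.exp_pos _).le

lemma lapIv_nonneg : 0 ≤ p.lapIv α s r := mul_nonneg (Real.exp_pos _).le (Real.exp_pos _).le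

/-- The two integrals in `lapIv` combine to a single one. -/
lemma lapIv_eq (hα : 1 < α) (hR : p.R = ∞ → 2 < α) (hs : 0 ≤ s) (hr : 0 < r) :
    p.lapIv α s r = Real.exp (-(2 * Real.pi * p.lamR *
      ∫ y in Ioi 0 ∩ {y | ENNReal.ofReal y ≤ p.R}, (1 - p.lapIn α s r y))) := by
  have hD : MeasurableSet {y : ℝ | ENNReal.ofReal y ≤ p.R} :=
    measurableSet_le ENNReal.measurable_ofReal measurable_const
  have hint := integrableOn_one_sub_lapIn hα hR hs hr
  have h1 : ∫ y in Ioi r ∩ {y | ENNReal.ofReal y ≤ p.R}, (1 - p.lapOut α s y) =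
      ∫ y in Ioi r ∩ {y | ENNReal.ofReal y ≤ p.R}, (1 - p.lapIn α s r y) :=
    setIntegral_congr_fun (measurableSet_Ioi.inter hD) fun y hy => by
      simp only [lapIn_eq_lapOut hr.le (le_of_lt hy.1)]
  have h2 : Ioi 0 ∩ {y | ENNReal.ofReal y ≤ p.R} = (Ioc 0 r ∩ {y | ENNReal.ofReal y ≤ p.R}) ∪
      (Ioi r ∩ {y | ENNReal.ofReal y ≤ p.R}) := by
    rw [← union_inter_distrib_right, Ioc_union_Ioi_eq_Ioi hr.le]
  rw [lapIv, h1, ← Real.exp_add, h2, setIntegral_union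
    (Ioc_disjoint_Ioi_same.mono inter_subset_left inter_subset_left) (measurableSet_Ioi.inter hD)
    (hint.mono_set (h2 ▸ subset_union_left)) (hint.mono_set (h2 ▸ subset_union_right))]
  ring_nf

lemma expNeg_lintegral_lines_interferenceFun (hα : 1 < α) (hR : p.R = ∞ → 2 < α) (hs : 0 ≤ s)
    (hr : 0 < r) :
    expNeg (ENNReal.ofReal p.lamR *
      ∫⁻ L, (1 - expNeg (p.lineExponent (interferenceFun p α r s) L))
        ∂((volume.restrict (Icc (0 : ℝ) Real.pi)).prod volume)) =
      ENNReal.ofReal (p.lapIv α s r) := by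
  have hlam := p.lamR_pos
  have hpi := Real.pi_pos
  have hD : MeasurableSet {y : ℝ | ENNReal.ofReal y ≤ p.R} :=
    measurableSet_le ENNReal.measurable_ofReal measurable_const
  have hD' : MeasurableSet {y : ℝ | ENNReal.ofReal |y| ≤ p.R} :=
    measurableSet_le (by fun_prop) measurable_const
  have h1 : ∀ L : ℝ × ℝ, 1 - expNeg (p.lineExponent (interferenceFun p α r s) L) =
      (fun y => if ENNReal.ofReal |y| ≤ p.R then ENNReal.ofReal (1 - p.lapIn α s r y) else 0)
        L.2 := by
    intro L
    rw [expNeg_lineExponent_interferenceFun hα hs hr L]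
    dsimp only
    split_ifs
    · rw [ENNReal.ofReal_sub 1 (q := p.lapIn α s r L.2) (Real.exp_pos _).le,
        ENNReal.ofReal_one]
    · rw [tsub_self]
  have hpos : ∀ y, 0 ≤ 1 - p.lapIn α s r y := fun y => sub_nonneg.2 (lapIn_le_one hs y)
  have h2 : ∫⁻ y in Ioi 0, (if ENNReal.ofReal |y| ≤ p.R then
      ENNReal.ofReal (1 - p.lapIn α s r y) else 0) =
      ENNReal.ofReal (∫ y in Ioi 0 ∩ {y | ENNReal.ofReal y ≤ p.R}, (1 - p.lapIn α s r y)) := by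
    rw [ofReal_integral_eq_lintegral_ofReal (integrableOn_one_sub_lapIn hα hR hs hr)
      (ae_of_all _ hpos), inter_comm, ← Measure.restrict_restrict hD, ← lintegral_indicator hD]
    refine setLIntegral_congr_fun measurableSet_Ioi fun y (hy : 0 < y) => ?_
    simp only [abs_of_pos hy, indicator]
    rfl
  simp_rw [h1]
  have hm : Measurable fun y => 1 - p.lapIn α s r y := measurable_const.sub measurable_lapIn
  rw [lintegral_lines (f := fun y => if ENNReal.ofReal |y| ≤ p.R then
      ENNReal.ofReal (1 - p.lapIn α s r y) else 0)
    (Measurable.ite hD' hm.ennreal_ofReal measurable_const)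
    (fun y => by simp only [abs_neg, lapIn_neg]), h2, ← ENNReal.ofReal_mul (by positivity),
    ← ENNReal.ofReal_mul hlam.le, expNeg_ofReal, lapIv_eq hα hR hs hr]
  · ring_nf
  · have := setIntegral_nonneg (μ := volume) ((measurableSet_Ioi (a := (0 : ℝ))).inter hD)
      fun y _ => hpos y
    positivity

lemma one_lt_alpha (p : Params) (M : Mode) : 1 < p.alpha M := by
  cases M
  · exact p.one_lt_alphav
  · exact p.one_lt_alphab

lemma two_lt_alpha (p : Params) (M : Mode) (h : p.R = ∞) : 2 < p.alpha M := by
  cases M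
  · exact (p.two_lt_of_R_eq_top h).1
  · exact (p.two_lt_of_R_eq_top h).2

end Params

namespace Network

variable {p : Params} {Ω : Type*} [mΩ : MeasurableSpace Ω] {P : Measure Ω} (N : Network p P)

lemma totalSum_interferenceFun (α r : ℝ) {s : ℝ} (hs : 0 ≤ s) (ω : Ω) :
    N.totalSum (interferenceFun p α r s) ω = ENNReal.ofReal s * (N.Iv α r ω + N.Ir α r ω) := by
  have h : ∀ k, N.lineSum (interferenceFun p α r s) k (N.line k ω) ω =
      if ENNReal.ofReal |(N.line k ω).2| ≤ p.R then ENNReal.ofReal s * N.roadPower α r k ω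
      else 0 := by
    intro k
    by_cases hk : ENNReal.ofReal |(N.line k ω).2| ≤ p.R
    · rw [if_pos hk, roadPower, ← ENNReal.tsum_mul_left]
      refine tsum_congr fun j => ?_
      simp only [interferenceFun, hk, true_and, mul_ite, mul_zero, ← ENNReal.ofReal_mul hs]
      rfl
    · simp [lineSum, interferenceFun, hk]
  simp only [totalSum, h]
  rw [Iv, Ir, mul_add, ← ENNReal.tsum_mul_left, add_comm]
  congr 1
  · refine tsum_congr fun i => ?_
    rw [mul_ite, mul_zero]
    rfl
  -- the road through the origin passes the test on `R`
  · simp [line]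

/-- The SINR exceeds `z` when the gain of the serving link exceeds the weighted interference and
noise, also when the latter are `0` or `∞`. -/
lemma lt_sinr_iff {M : Mode} {z r : ℝ} (hz : 0 < z) (hr : 0 < r) {ω : Ω} :
    ENNReal.ofReal z < N.sinr M r ω ↔
      ENNReal.ofReal (z / (p.Pv * r ^ (-(p.alpha M)))) *
        (N.Iv (p.alpha M) r ω + N.Ir (p.alpha M) r ω + ENNReal.ofReal p.noise) <
      ENNReal.ofReal (N.linkGain ω) := by
  have hPv := p.Pv_pos
  set a := p.Pv * r ^ (-(p.alpha M)) with ha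
  have ha0 : 0 < a := by positivity
  set X := N.Iv (p.alpha M) r ω + N.Ir (p.alpha M) r ω + ENNReal.ofReal p.noise with hX
  have hane : ENNReal.ofReal a ≠ 0 := by simpa using ha0
  rw [sinr, ← ha, ← hX, ENNReal.lt_div_iff_mul_lt (Or.inr ENNReal.ofReal_ne_top)
    (Or.inr (by simpa using hz)),
    ENNReal.ofReal_mul ha0.le, ENNReal.ofReal_div_of_pos ha0]
  rw [← ENNReal.mul_lt_mul_iff_right hane ENNReal.ofReal_ne_top
    (b := ENNReal.ofReal z / ENNReal.ofReal a * X), ← mul_assoc,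
    ENNReal.mul_div_cancel hane ENNReal.ofReal_ne_top]

variable [IsProbabilityMeasure P]

theorem condSuccess_eq (M : Mode) {z r : ℝ} (hz : 0 < z) (hr : 0 < r) :
    N.condSuccess M z r = ENNReal.ofReal (p.succ M z r) := by
  have hPv := p.Pv_pos
  have hnoise := p.noise_nonneg
  have hα := p.one_lt_alpha M
  set α := p.alpha M with hαdef
  set s := z / (p.Pv * r ^ (-α)) with hs
  have hs0 : 0 ≤ s := by positivity
  have hsP : s * p.Pv = z * r ^ α := by
    rw [hs, Real.rpow_neg hr.le]
    field_simp
  have hHm := measurable_interferenceFun p α r s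
  have hTm : Measurable[N.algebraOf vehicleSources] fun ω =>
      N.totalSum (interferenceFun p α r s) ω + ENNReal.ofReal (s * p.noise) :=
    Measurable.add_const (N.measurable_totalSum hHm) _
  have h1 : N.condSuccess M z r = P {ω | N.totalSum (interferenceFun p α r s) ω +
      ENNReal.ofReal (s * p.noise) < ENNReal.ofReal (N.linkGain ω)} := by
    refine congrArg P (Set.ext fun ω => ?_)
    change ENNReal.ofReal z < N.sinr M r ω ↔ N.totalSum (interferenceFun p α r s) ω +
      ENNReal.ofReal (s * p.noise) < ENNReal.ofReal (N.linkGain ω)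
    rw [N.lt_sinr_iff hz hr, totalSum_interferenceFun N α r hs0, ENNReal.ofReal_mul hs0, mul_add]
  have hind := N.indepFun_of_disjoint (S := vehicleSources) (T := {.linkGain})
    (by simp [vehicleSources, roadSources]) hTm (N.measurable_algebraOf_linkGain (by simp))
  rw [h1, measure_lt_ofReal_of_indepFun (hTm.mono (N.algebraOf_le _) le_rfl)
    N.linkGain_measurable N.linkGain_law hind]
  simp_rw [expNeg_add]
  rw [lintegral_mul_const (f := fun ω => expNeg (N.totalSum (interferenceFun p α r s) ω)) _
      (measurable_expNeg.comp ((N.measurable_totalSum hHm).mono (N.algebraOf_le _) le_rfl)),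
    N.lintegral_expNeg_totalSum hHm, Params.expNeg_lineExponent_interferenceFun hα hs0 hr,
    Params.expNeg_lintegral_lines_interferenceFun hα (p.two_lt_alpha M) hs0 hr]
  simp only [abs_zero, ENNReal.ofReal_zero, zero_le, if_true]
  rw [Params.lapIn_zero_eq_lapIr hα hz hr hsP, expNeg_ofReal (by positivity),
    ← ENNReal.ofReal_mul Params.lapIr_nonneg,
    ← ENNReal.ofReal_mul (mul_nonneg Params.lapIr_nonneg Params.lapIv_nonneg), Params.succ]
  congr 1
  rw [← hαdef, ← hs, show s * p.noise = z * p.noise / (p.Pv * r ^ (-α)) by rw [hs]; ring]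
  ring

end Network

/-! ### The overall success probability -/

/-- Integration of a `[0, 1]`-valued function with a real expression on `(0, ∞)` against a density.
Measurability is required of `F` only. -/
lemma integrableOn_and_lintegral_withDensity {f w : ℝ → ℝ} {F : ℝ → ℝ≥0∞} (hF : Measurable F)
    (hF1 : ∀ r, F r ≤ 1) (hf : ∀ r, 0 < r → 0 ≤ f r) (hFf : ∀ r, 0 < r → F r = ENNReal.ofReal (f r))
    (hw : IntegrableOn w (Ioi 0)) (hw0 : ∀ r, 0 < r → 0 ≤ w r) :
    IntegrableOn (fun r => f r * w r) (Ioi 0) ∧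
      ∫⁻ r, F r ∂((volume.restrict (Ioi 0)).withDensity fun r => ENNReal.ofReal (w r)) =
        ENNReal.ofReal (∫ r in Ioi 0, f r * w r) := by
  have hfF : ∀ r ∈ Ioi (0 : ℝ), (F r).toReal = f r := fun r hr => by
    rw [hFf r hr, ENNReal.toReal_ofReal (hf r hr)]
  have hint : IntegrableOn (fun r => f r * w r) (Ioi 0) := by
    refine IntegrableOn.congr_fun (f := fun r => (F r).toReal * w r) ?_
      (fun r hr => by simp only [hfF r hr]) measurableSet_Ioi
    refine Integrable.bdd_mul (c := 1) hw hF.ennreal_toReal.aestronglyMeasurable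
      (ae_of_all _ fun r => ?_)
    rw [Real.norm_eq_abs, abs_of_nonneg ENNReal.toReal_nonneg]
    exact ENNReal.toReal_le_of_le_ofReal zero_le_one (by simpa using hF1 r)
  refine ⟨hint, ?_⟩
  rw [lintegral_withDensity_eq_lintegral_mul₀ hw.aemeasurable.ennreal_ofReal hF.aemeasurable,
    ofReal_integral_eq_lintegral_ofReal hint ((ae_restrict_iff' measurableSet_Ioi).2
      (ae_of_all _ fun r hr => mul_nonneg (hf r hr) (hw0 r hr)))]
  refine setLIntegral_congr_fun measurableSet_Ioi fun r hr => ?_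
  rw [Pi.mul_apply, hFf r hr, mul_comm, ENNReal.ofReal_mul (hf r hr)]

namespace Network

variable {p : Params} {Ω : Type*} [mΩ : MeasurableSpace Ω] {P : Measure Ω} (N : Network p P)

lemma measurable_roadPower (α : ℝ) (k : Option ℕ) :
    Measurable fun q : ℝ × Ω => N.roadPower α q.1 k q.2 := by
  refine Measurable.tsum fun j => ?_
  have hpos : Measurable fun q : ℝ × Ω => N.position k j q.2 :=
    ((N.measurable_position k j).mono (N.algebraOf_le _) le_rfl).comp measurable_snd
  have hgain : Measurable fun q : ℝ × Ω => N.gain k j q.2 :=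
    (N.gain_measurable k j).comp measurable_snd
  exact Measurable.ite (measurableSet_lt measurable_fst hpos.norm) (by fun_prop) measurable_const

/-- Joint measurability in the link distance and the outcome. -/
lemma measurable_sinr (M : Mode) : Measurable fun q : ℝ × Ω => N.sinr M q.1 q.2 := by
  have hIr : Measurable fun q : ℝ × Ω => N.Ir (p.alpha M) q.1 q.2 := N.measurable_roadPower _ _
  have hIv : Measurable fun q : ℝ × Ω => N.Iv (p.alpha M) q.1 q.2 := by
    refine Measurable.tsum fun i => Measurable.ite (measurableSet_le ?_ measurable_const)
      (N.measurable_roadPower _ _) measurable_const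
    have := N.measurable_road i
    fun_prop
  have hl : Measurable fun q : ℝ × Ω => N.linkGain q.2 := N.linkGain_measurable.comp measurable_snd
  unfold sinr
  fun_prop

/-- The pairs of distances `(R_v, R_b)` for which the V2V link is selected. -/
lemma measurableSet_v2v :
    MeasurableSet {q : ℝ × ℝ | q.2 ^ (-p.alphab) ≤ p.B * q.1 ^ (-p.alphav)} :=
  measurableSet_le (by fun_prop) (by fun_prop)

lemma condAssocV2V_eq_map (r : ℝ) :
    N.condAssocV2V r = P.map N.Rb
      (Prod.mk r ⁻¹' {q : ℝ × ℝ | q.2 ^ (-p.alphab) ≤ p.B * q.1 ^ (-p.alphav)}) := by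
  rw [Measure.map_apply N.measurable_Rb (measurable_prodMk_left measurableSet_v2v)]
  rfl

lemma condAssocV2B_eq_map (r : ℝ) :
    N.condAssocV2B r = P.map N.Rv
      ((fun x => (x, r)) ⁻¹' {q : ℝ × ℝ | q.2 ^ (-p.alphab) ≤ p.B * q.1 ^ (-p.alphav)}ᶜ) := by
  rw [Measure.map_apply N.measurable_Rv (measurable_prodMk_right measurableSet_v2v.compl)]
  refine congrArg P (Set.ext fun ω => ?_)
  change p.B * N.Rv ω ^ (-p.alphav) < r ^ (-p.alphab) ↔
    ¬ r ^ (-p.alphab) ≤ p.B * N.Rv ω ^ (-p.alphav)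
  exact not_le.symm

variable [IsProbabilityMeasure P]

lemma measurable_condSuccess (M : Mode) (z : ℝ) : Measurable fun r => N.condSuccess M z r := by
  have h : MeasurableSet {q : ℝ × Ω | ENNReal.ofReal z < N.sinr M q.1 q.2} :=
    measurableSet_lt measurable_const (N.measurable_sinr M)
  exact measurable_measure_prodMk_left h

lemma measurable_condAssocV2V : Measurable N.condAssocV2V := by
  rw [funext N.condAssocV2V_eq_map]
  exact measurable_measure_prodMk_left measurableSet_v2v

lemma measurable_condAssocV2B : Measurable N.condAssocV2B := by
  rw [funext N.condAssocV2B_eq_map]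
  exact measurable_measure_prodMk_right measurableSet_v2v.compl

/-- By the independence of the two distances, the mode can be averaged out given the distance of
the selected link. -/
lemma success_eq_lintegral (z : ℝ) :
    N.success z = ∫⁻ r, N.condSuccess .v2v z r * N.condAssocV2V r ∂(P.map N.Rv) +
      ∫⁻ r, N.condSuccess .v2b z r * N.condAssocV2B r ∂(P.map N.Rb) := by
  set A := {q : ℝ × ℝ | q.2 ^ (-p.alphab) ≤ p.B * q.1 ^ (-p.alphav)} with hA
  have hAm : MeasurableSet A := measurableSet_v2v
  have hS := fun M => N.measurable_condSuccess M z
  have := Measure.isProbabilityMeasure_map (μ := P) N.measurable_Rv.aemeasurable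
  have := Measure.isProbabilityMeasure_map (μ := P) N.measurable_Rb.aemeasurable
  let G₁ : ℝ × ℝ → ℝ≥0∞ := A.indicator fun q => N.condSuccess .v2v z q.1
  let G₂ : ℝ × ℝ → ℝ≥0∞ := Aᶜ.indicator fun q => N.condSuccess .v2b z q.2
  have hG₁ : Measurable G₁ := ((hS .v2v).comp measurable_fst).indicator hAm
  have hG₂ : Measurable G₂ := ((hS .v2b).comp measurable_snd).indicator hAm.compl
  have h1 : ∀ ω, N.condSuccess (N.mode ω) z (N.dist (N.mode ω) ω) =
      G₁ (N.Rv ω, N.Rb ω) + G₂ (N.Rv ω, N.Rb ω) := by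
    intro ω
    by_cases h : N.Rb ω ^ (-p.alphab) ≤ p.B * N.Rv ω ^ (-p.alphav)
    · have hmem : (N.Rv ω, N.Rb ω) ∈ A := h
      simp only [G₁, G₂, indicator_of_mem hmem, indicator_of_notMem (notMem_compl_iff.2 hmem),
        add_zero, mode, if_pos h, dist]
    · have hmem : (N.Rv ω, N.Rb ω) ∉ A := h
      simp only [G₁, G₂, indicator_of_notMem hmem, indicator_of_mem (mem_compl hmem), zero_add,
        mode, if_neg h, dist]
  have hpair := N.measurable_Rv.prodMk N.measurable_Rb
  rw [success]
  simp_rw [h1]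
  rw [← lintegral_map (f := fun q => G₁ q + G₂ q) (hG₁.add hG₂) hpair,
    (indepFun_iff_map_prod_eq_prod_map_map N.measurable_Rv.aemeasurable
      N.measurable_Rb.aemeasurable).1 N.indepFun_Rv_Rb, lintegral_add_left hG₁,
    lintegral_prod _ hG₁.aemeasurable, lintegral_prod_symm _ hG₂.aemeasurable]
  congr 1
  · refine lintegral_congr fun x => ?_
    rw [N.condAssocV2V_eq_map, ← hA,
      ← lintegral_indicator_const (measurable_prodMk_left hAm)]
    rfl
  · refine lintegral_congr fun y => ?_
    rw [N.condAssocV2B_eq_map, ← hA,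
      ← lintegral_indicator_const (measurable_prodMk_right hAm.compl)]
    rfl

end Network

lemma Params.succ_nonneg (p : Params) (M : Mode) (z r : ℝ) : 0 ≤ p.succ M z r :=
  mul_nonneg (mul_nonneg (Real.exp_pos _).le lapIv_nonneg) lapIr_nonneg

end V2X

end

theorem mainTheorem3 {Ω : Type*} [MeasurableSpace Ω] (P : MeasureTheory.Measure Ω)
    [MeasureTheory.IsProbabilityMeasure P] (p : V2X.Params) (N : V2X.Network p P)
    (z : ℝ) (hz : 0 < z) :
    ProbabilityTheory.HasLaw N.Rv
      ((MeasureTheory.volume.restrict (Set.Ioi (0 : ℝ))).withDensity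
        (fun r => ENNReal.ofReal (p.pdfRv r))) P ∧
    ProbabilityTheory.HasLaw N.Rb
      ((MeasureTheory.volume.restrict (Set.Ioi (0 : ℝ))).withDensity
        (fun r => ENNReal.ofReal (p.pdfRb r))) P ∧
    (∀ r : ℝ, 0 < r → ∀ M : V2X.Mode, N.condSuccess M z r = ENNReal.ofReal (p.succ M z r)) ∧
    (∀ r : ℝ, 0 < r → N.condAssocV2V r = ENNReal.ofReal (p.assocV2V r)) ∧
    (∀ r : ℝ, 0 < r → N.condAssocV2B r = ENNReal.ofReal (p.assocV2B r)) ∧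
    MeasureTheory.IntegrableOn
      (fun r => p.succ .v2v z r * p.assocV2V r * p.pdfRv r) (Set.Ioi 0) ∧
    MeasureTheory.IntegrableOn
      (fun r => p.succ .v2b z r * p.assocV2B r * p.pdfRb r) (Set.Ioi 0) ∧
    (N.success z).toReal =
      (∫ r in Set.Ioi (0 : ℝ), p.succ .v2v z r * p.assocV2V r * p.pdfRv r) +
      ∫ r in Set.Ioi (0 : ℝ), p.succ .v2b z r * p.assocV2B r * p.pdfRb r := by
  have hv0 : ∀ r, 0 ≤ p.succ .v2v z r * p.assocV2V r := fun r =>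
    mul_nonneg (p.succ_nonneg _ z r) (Real.exp_pos _).le
  have hb0 : ∀ r, 0 ≤ p.succ .v2b z r * p.assocV2B r := fun r =>
    mul_nonneg (p.succ_nonneg _ z r) (Real.exp_pos _).le
  obtain ⟨hv, hv'⟩ := V2X.integrableOn_and_lintegral_withDensity
    ((N.measurable_condSuccess .v2v z).mul N.measurable_condAssocV2V)
    (fun r => mul_le_one' prob_le_one prob_le_one) (fun r _ => hv0 r)
    (fun r hr => by
      rw [Pi.mul_apply, N.condSuccess_eq _ hz hr, N.condAssocV2V_eq hr,
        ENNReal.ofReal_mul (p.succ_nonneg _ z r)])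
    p.integrableOn_pdfRv fun r hr => p.pdfRv_nonneg hr
  obtain ⟨hb, hb'⟩ := V2X.integrableOn_and_lintegral_withDensity
    ((N.measurable_condSuccess .v2b z).mul N.measurable_condAssocV2B)
    (fun r => mul_le_one' prob_le_one prob_le_one) (fun r _ => hb0 r)
    (fun r hr => by
      rw [Pi.mul_apply, N.condSuccess_eq _ hz hr, N.condAssocV2B_eq hr,
        ENNReal.ofReal_mul (p.succ_nonneg _ z r)])
    p.integrableOn_pdfRb fun r hr => p.pdfRb_nonneg hr
  refine ⟨N.hasLaw_Rv, N.hasLaw_Rb, fun r hr M => N.condSuccess_eq M hz hr,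
    fun r hr => N.condAssocV2V_eq hr, fun r hr => N.condAssocV2B_eq hr, hv, hb, ?_⟩
  have hnv := setIntegral_nonneg (μ := volume) (measurableSet_Ioi (a := (0 : ℝ))) fun r hr =>
    mul_nonneg (hv0 r) (p.pdfRv_nonneg hr)
  have hnb := setIntegral_nonneg (μ := volume) (measurableSet_Ioi (a := (0 : ℝ))) fun r hr =>
    mul_nonneg (hb0 r) (p.pdfRb_nonneg hr)
  simp only [Pi.mul_apply] at hv' hb'
  rw [N.success_eq_lintegral, N.hasLaw_Rv.map_eq, N.hasLaw_Rb.map_eq, hv', hb',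
    ← ENNReal.ofReal_add hnv hnb, ENNReal.toReal_ofReal (add_nonneg hnv hnb)]
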